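/- **Setting.** Consider a program $\mathit{Prgm}$ of the active object language CAO: classes with object references as constant parameters, fields and methods, and a main block that creates finitely many objects and performs one asynchronous call. Statements are $\mathsf{skip}$, assignment to a variable or field, $v = e.\mathsf{get}_i$, the asynchronous call $v = l!m(\bar e)$, $\mathsf{await}$ on a future or a Boolean guard, $\mathsf{return}\ e$, $\mathsf{while}$, $\mathsf{if}$ and sequence. *Locally abstract semantics.* An object state is a pair (local state, heap). A local trace $sc \triangleright hs$ consists of a selection condition $sc$ (a set of symbolic expressions) and a history $hs$ that alternates between object states and elements that are events or the suspension marker $\diamond$. The events are $\mathsf{invEv}(X,X',f,m,\bar e)$ (call), $\mathsf{invREv}(X,f,m,\bar e)$ (start of the called method), $\mathsf{futEv}(X,f,m,e)$ (return), $\mathsf{futREv}(X,f,m,e,i)$ (read of a future resolved by $m$), the four suspension events, and $\mathsf{noEv}$. The semantics of a statement or method in a (symbolic) state is a set of such traces: a read introduces a fresh symbolic value, a call a fresh symbolic future, an $\mathsf{await}$ a fresh symbolic heap, each branching adds its guard or the negated guard to $sc$, and a trace of method $m$ is $\langle s,\mathsf{invREv},s\rangle$ continued by a trace of its body $\mathbf{s}_m$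 from $s$. *Globally concrete semantics.* A process is a set of traces. It executes a step by agreement: the heap of the object is substituted in its traces, the symbolic values introduced by their first event are replaced by semantic values, and all traces whose now evaluable selection conditions are true must have the same, fully concrete, first step; the continuation consists of the remainders of those traces. An object has a process pool, an object trace and at most one active process; a system has a global event sequence and objects, where a read must return the value with which the future was resolved, and a call uses a fresh future and adds the semantics of the called method, in a symbolic heap, to the pool of the callee (another object). A run is terminating if it ends with all pools empty and no active process. *Selected traces.* Let $\theta$ be a trace of $m$ in the semantics with fully symbolic object, future, local state and heap. Let $\chi$ map symbolic values and symbolic fields to semantic values. The trace $\theta$ is *selected as* $\theta\chi$ if in some terminating run of $\mathit{Prgm}$ a process of $m$ is started (by a call, or by the call of the main block) with a trace $\theta'$ that results from $\theta$ by substitutions contained in $\chi$, $\theta'$ is selected at each agreement of that process until it is finished, and $\chi$ contains all substitutions made in these agreements. For a statement $\mathbf{s}$ of $m$ and a concrete state $(\sigma,\rho)$, the selected traces of $\mathbf{s}$ from $(\sigma,\rho)$ are the concretizations $\tau\chi$, starting in $(\sigma,\rho)$, of those suffixes $\tau$ of selected traces $\theta$ of $m$ that are generated by $\mathbf{s}$.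 *Method types.* A first-order state formula $\varphi$ is evaluated in concrete object states under an interpretation $I$ that gives the operators, $\mathsf{select}$ and $\mathsf{store}$ their natural meaning. Method types are $$L ::= X!m(\varphi) \mid\ \downarrow\!(\varphi) \mid \mathsf{skip} \mid L.L \mid L^{*} \mid \oplus\{L_i\}_{i\in I}\ (I \text{ finite and non-empty}) \mid \&(\bar m,\varphi)\{L_1,L_2\}.$$ A type $L$ is translated to a monadic second-order formula $\alpha_{met}(L)$ over concrete histories: there are objects for the roles $X$ that are stored, in the first state, in the fields assigned to the roles, such that $\alpha'(L)$ holds. Here - $\alpha'(X!m(\varphi))$: there is exactly one event other than $\mathsf{noEv}$; it is $\mathsf{invEv}(x,X,f,m,\bar e)$ for some $x,f,\bar e$, and the state before it satisfies $\varphi$ with the parameters of $m$ replaced by $\bar e$; - $\alpha'(\downarrow\!(\varphi))$: the same with $\mathsf{futEv}(x,f,m,e)$, for some $x,f,m,e$, and $\varphi[\mathsf{result}\setminus e]$; - $\alpha'(\mathsf{skip})$: all elements are states or $\mathsf{noEv}$; - $\alpha'(L_1.L_2)$: for some state position $i$, $\alpha'(L_1)$ holds relativized to the positions $\le i$ and $\alpha'(L_2)$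 relativized to those $\ge i$; - $\alpha'(L^{*})$: there are a set $J$ of state positions and $a,b\in J$ such that every position lies in $[a,b]$ or lies before $a$ and does not carry an event other than $\mathsf{noEv}$, and for all consecutive $i<j$ in $J$, $\alpha'(L)$ holds relativized to $[i,j]$; - $\alpha'(\oplus\{L_i\})=\bigvee_i\alpha'(L_i)$; - $\alpha'(\&(\bar m,\varphi)\{L_1,L_2\})$: there are positions $i<j<k$ such that each position is $j$, or at least $k$, or at most $i$ with a state or $\mathsf{noEv}$; position $j$ carries $\mathsf{futREv}(x,f,m',e,n)$ for some $x,f,e,n$ and $m'\in\bar m$; and, relativized to the positions $\ge k$, $\alpha'(L_1)$ holds if the state at $k$ satisfies $\varphi[\mathsf{result}\setminus e]$, and $\alpha'(L_2)$ holds otherwise. Each method $m$ has a local protocol $?m(\varphi_m).L_m$, where $\varphi_m$ is a predicate on the parameters of $m$ (it mentions neither the heap nor other program variables). The proof obligation $\varphi_m\Rightarrow[\mathbf{s}_m\leadsto^{\alpha_{met}}L_m]$ is *valid* if for every concrete state $(\sigma,\rho)$ and every assignment $\beta$ of logical variables with $(\sigma,\rho),I,\beta\models\varphi_m$, every selected trace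 of $\mathbf{s}_m$ from $(\sigma,\rho)$ is a model of $\alpha_{met}(L_m)$ under $I,\beta$. The obligation scheme is *consistent* if, whenever a call action $X!m(\varphi)$ occurs in $L_{m'}$ for methods $m,m'$ (possibly equal), $\varphi$ implies $\varphi_m$ in all states and under all assignments, and the precondition of the method called by the main block is valid. **Corollary.** Assume that (1) for every method $m$ of $\mathit{Prgm}$ the proof obligation $\varphi_m\Rightarrow[\mathbf{s}_m\leadsto^{\alpha_{met}}L_m]$ is valid, and (2) the obligation scheme is consistent. Then for every method $m$ and every trace $\theta$ of $m$ that is selected as $\theta\chi$ in $\mathit{Prgm}$, $\theta\chi$ is fully concrete, and the suffix of its history after the invocation reaction event is a model of $\alpha_{met}(L_m)$ (under $I$ and every $\beta$). -/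

import Mathlib

namespace CAO

/-! ### Names, data types and semantic values -/

abbrev ClassName := ℕ
abbrev FieldName := ℕ

/-- Local variables. `result` is the reserved variable that only occurs in specifications. -/
inductive VarName
  | result
  | user (n : ℕ)
  deriving DecidableEq

/-- Fully qualified method names `C.m`. -/
structure MName where
  cls : ClassName
  name : ℕ
  deriving DecidableEq

/-- Data types `D`. -/
inductive Ty
  | rat | unit | int | bool
  | list (D : Ty)
  | fut (D : Ty)

/-- Semantic values. Integers are the integral rationals; `fut none` is the unique future `no`
that is never resolved. Method names are included because a resolving reaction event stores the
method that resolved the future it reads. -/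
inductive Value
  | unit
  | bool (b : Bool)
  | num (q : ℚ)
  | obj (i : ℕ)
  | fut (f : Option ℕ)
  | list (l : List Value)
  | meth (m : MName)

/-- The default value of a data type. -/
def Ty.default : Ty → Value
  | .rat => .num 0
  | .unit => .unit
  | .int => .num 0
  | .bool => .bool false
  | .list _ => .list []
  | .fut _ => .fut none

/-- The set of semantic values of a data type. -/
def Ty.values : Ty → Set Value
  | .rat => {v | ∃ q : ℚ, v = .num q}
  | .unit => {.unit}
  | .int => {v | ∃ z : ℤ, v = .num z}
  | .bool => {v | ∃ b, v = .bool b}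
  | .list D => {v | ∃ l : List Value, v = .list l ∧ ∀ w ∈ l, w ∈ D.values}
  | .fut _ => {v | ∃ f, v = .fut f}

/-- The future `n` occurs in a value. -/
inductive Value.HasFut (n : ℕ) : Value → Prop
  | here : HasFut n (.fut (some n))
  | inList {l : List Value} {v : Value} : v ∈ l → HasFut n v → HasFut n (.list l)

inductive UnOp
  | len | hd | tl | not | neg

inductive BinOp
  | cons | and | or | add | sub | mul | div | lt | le | eq

/-- Natural evaluation of unary operators; undefined (`none`) e.g. for the head of `Nil`. -/
def UnOp.eval : UnOp → Value → Option Value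
  | .len, .list l => some (.num (l.length : ℚ))
  | .hd, .list (v :: _) => some v
  | .tl, .list (_ :: l) => some (.list l)
  | .not, .bool b => some (.bool (!b))
  | .neg, .num q => some (.num (-q))
  | _, _ => none

open Classical in
/-- Natural evaluation of binary operators; undefined (`none`) e.g. for division by zero. -/
noncomputable def BinOp.eval : BinOp → Value → Value → Option Value
  | .cons, v, .list l => some (.list (v :: l))
  | .and, .bool a, .bool b => some (.bool (a && b))
  | .or, .bool a, .bool b => some (.bool (a || b))
  | .add, .num p, .num q => some (.num (p + q))
  | .sub, .num p, .num q => some (.num (p - q))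
  | .mul, .num p, .num q => some (.num (p * q))
  | .div, .num p, .num q => if q = 0 then none else some (.num (p / q))
  | .lt, .num p, .num q => some (.bool (decide (p < q)))
  | .le, .num p, .num q => some (.bool (decide (p ≤ q)))
  | .eq, v, w => some (.bool (decide (v = w)))
  | _, _, _ => none

/-! ### Programs -/

/-- Locations: a local variable or a field `this.f`. -/
inductive Loc
  | var (v : VarName)
  | field (f : FieldName)

inductive Expr
  | loc (l : Loc)
  | num (n : ℕ)
  | never | nil | true | false
  | un (o : UnOp) (e : Expr)
  | bin (o : BinOp) (e e' : Expr)

/-- Guards of `await`: a Boolean expression `e` or a future guard `e?`. -/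
inductive Guard
  | cond (e : Expr)
  | fut (e : Expr)

/-- Statements. An optional data type turns an assignment into a declaration. -/
inductive Stmt
  | skip
  | assign (D : Option Ty) (l : Loc) (e : Expr)
  | get (D : Option Ty) (v : VarName) (e : Expr) (i : ℕ)
  | call (D : Option Ty) (v : VarName) (target : Loc) (m : MName) (args : List Expr)
  | await (g : Guard) (i : ℕ)
  | ret (e : Expr)
  | while (e : Expr) (s : Stmt)
  | ite (e : Expr) (s s' : Stmt)
  | seq (s s' : Stmt)

/-- The local variables declared in a statement, with their data types. -/
def Stmt.decls : Stmt → List (VarName × Ty)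
  | .assign (some D) (.var v) _ => [(v, D)]
  | .get (some D) v _ _ => [(v, D)]
  | .call (some D) v _ _ _ => [(v, D)]
  | .while _ s => s.decls
  | .ite _ s s' => s.decls ++ s'.decls
  | .seq s s' => s.decls ++ s'.decls
  | _ => []

structure MethDecl where
  ret : Ty
  name : ℕ
  params : List (Ty × VarName)
  body : Stmt

/-- Fields. A field without an initializer starts with the default value of its data type. -/
structure FieldDecl where
  type : Ty
  name : FieldName
  initial : Option Expr

/-- Classes; `params` are the references to other objects, which act as constant fields. -/
structure ClassDecl where
  name : ClassName
  params : List (ClassName × FieldName)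
  fields : List FieldDecl
  meths : List MethDecl

/-- An object creation `C v = new C(args)` of the main block. -/
structure Creation where
  cls : ClassName
  var : VarName
  args : List VarName

/-- A program: its classes and its main block, which creates objects and performs one call. -/
structure Program where
  classes : List ClassDecl
  objects : List Creation
  callTarget : VarName
  callMeth : MName
  callArgs : List Expr

def ClassDecl.parNames (C : ClassDecl) : List FieldName := C.params.map Prod.snd

def Program.findClass (P : Program) (c : ClassName) : Option ClassDecl :=
  P.classes.find? (fun C => C.name = c)

def Program.lookup (P : Program) (m : MName) : Option (ClassDecl × MethDecl) :=
  (P.findClass m.cls).bind fun C => (C.meths.find? (fun M => M.name = m.name)).map fun M => (C, M)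

/-- The names of the formal parameters of a method. -/
def Program.paramNames (P : Program) (m : MName) : List VarName :=
  match P.lookup m with
  | some (_, M) => M.params.map Prod.snd
  | none => []

/-! ### Symbolic expressions, states, events and traces -/

/-- Placeholders: symbolic values and symbolic fields. `fresh k` and `freshMeth k` are the fresh
symbolic values introduced by events (`freshMeth` for the method that resolved a future),
`field f i` is the symbolic field `this.f` with counter `i`; `loc v`, `cparam p`, `self`, `fut`
are the symbolic values of a variable, of a class parameter, of the object name and of the resolved
future in a fully symbolic start. -/
inductive Sym
  | fresh (k : ℕ)
  | freshMeth (k : ℕ)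
  | field (f : FieldName) (i : ℕ)
  | loc (v : VarName)
  | cparam (p : FieldName)
  | self
  | fut

inductive SymExpr
  | val (v : Value)
  | sym (x : Sym)
  | un (o : UnOp) (e : SymExpr)
  | bin (o : BinOp) (e e' : SymExpr)

/-- Apply a unary operator; operators on semantic values are evaluated where they are defined. -/
def SymExpr.mkUn (o : UnOp) : SymExpr → SymExpr
  | .val v => match o.eval v with
    | some w => .val w
    | none => .un o (.val v)
  | e => .un o e

/-- Apply a binary operator; operators on semantic values are evaluated where they are defined. -/
noncomputable def SymExpr.mkBin (o : BinOp) : SymExpr → SymExpr → SymExpr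
  | .val v, .val v' => match o.eval v v' with
    | some w => .val w
    | none => .bin o (.val v) (.val v')
  | e, e' => .bin o e e'

/-- Partial substitutions of placeholders by semantic values. -/
abbrev Subst := Sym → Option Value

/-- Concretizers. -/
abbrev Concretizer := Sym → Value

def Concretizer.toSubst (χ : Concretizer) : Subst := fun x => some (χ x)

/-- Substitution, with evaluation of the resulting semantic values. -/
noncomputable def SymExpr.subst (δ : Subst) : SymExpr → SymExpr
  | .val v => .val v
  | .sym x => match δ x with
    | some v => .val v
    | none => .sym x
  | .un o e => .mkUn o (e.subst δ)
  | .bin o e e' => .mkBin o (e.subst δ) (e'.subst δ)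

/-- The placeholders of a symbolic expression. -/
def SymExpr.syms : SymExpr → Set Sym
  | .val _ => ∅
  | .sym x => {x}
  | .un _ e => e.syms
  | .bin _ e e' => e.syms ∪ e'.syms

/-- Object states: a local state and a heap, with entries in `E` (symbolic expressions or
semantic values). -/
structure State (E : Type) where
  loc : VarName → E
  heap : FieldName → E

def State.map {E F : Type} (g : E → F) (s : State E) : State F :=
  ⟨fun v => g (s.loc v), fun f => g (s.heap f)⟩

def State.setLoc {E : Type} (s : State E) (v : VarName) (a : E) : State E :=
  ⟨Function.update s.loc v a, s.heap⟩

def State.setHeap {E : Type} (s : State E) (f : FieldName) (a : E) : State E :=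
  ⟨s.loc, Function.update s.heap f a⟩

def State.set {E : Type} (s : State E) : Loc → E → State E
  | .var v, a => s.setLoc v a
  | .field f, a => s.setHeap f a

/-- Evaluation of a syntactic expression in a (possibly symbolic) object state. -/
noncomputable def Expr.eval (s : State SymExpr) : Expr → SymExpr
  | .loc (.var v) => s.loc v
  | .loc (.field f) => s.heap f
  | .num n => .val (.num n)
  | .never => .val (.fut none)
  | .nil => .val (.list [])
  | .true => .val (.bool Bool.true)
  | .false => .val (.bool Bool.false)
  | .un o e => .mkUn o (e.eval s)
  | .bin o e e' => .mkBin o (e.eval s) (e'.eval s)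

/-- Events. -/
inductive Event (E : Type)
  | invEv (X X' f : E) (m : MName) (args : List E)
  | invREv (X f : E) (m : MName) (args : List E)
  | futEv (X f : E) (m : MName) (e : E)
  | futREv (X f m e : E) (i : ℕ)
  | condEv (X f : E) (g : Expr) (i : ℕ)
  | condREv (X f : E) (g : Expr) (i : ℕ)
  | suspEv (X f e : E) (i : ℕ)
  | suspREv (X f e : E) (i : ℕ)
  | noEv

def Event.map {E F : Type} (g : E → F) : Event E → Event F
  | .invEv X X' f m as => .invEv (g X) (g X') (g f) m (as.map g)
  | .invREv X f m as => .invREv (g X) (g f) m (as.map g)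
  | .futEv X f m e => .futEv (g X) (g f) m (g e)
  | .futREv X f m e i => .futREv (g X) (g f) (g m) (g e) i
  | .condEv X f e i => .condEv (g X) (g f) e i
  | .condREv X f e i => .condREv (g X) (g f) e i
  | .suspEv X f e i => .suspEv (g X) (g f) (g e) i
  | .suspREv X f e i => .suspREv (g X) (g f) (g e) i
  | .noEv => .noEv

/-- The components of an event. -/
def Event.vals {E : Type} : Event E → List E
  | .invEv X X' f _ as => X :: X' :: f :: as
  | .invREv X f _ as => X :: f :: as
  | .futEv X f _ e => [X, f, e]
  | .futREv X f m e _ => [X, f, m, e]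
  | .condEv X f _ _ => [X, f]
  | .condREv X f _ _ => [X, f]
  | .suspEv X f e _ => [X, f, e]
  | .suspREv X f e _ => [X, f, e]
  | .noEv => []

/-- `condEv` and `suspEv` suspend the executing process. -/
def Event.Suspends {E : Type} : Event E → Prop
  | .condEv _ _ _ _ => True
  | .suspEv _ _ _ _ => True
  | _ => False

def Event.IsInv {E : Type} : Event E → Prop
  | .invEv _ _ _ _ _ => True
  | _ => False

def Event.IsFutR {E : Type} : Event E → Prop
  | .futREv _ _ _ _ _ => True
  | _ => False

/-- The symbolic values introduced by an event: the future of an invocation event, the read value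
(and the resolving method) of a resolving reaction event. -/
def Event.introduced : Event SymExpr → Set Sym
  | .invEv _ _ f _ _ => {x | f = .sym x}
  | .futREv _ _ m e _ => {x | m = .sym x ∨ e = .sym x}
  | _ => ∅

/-- Elements of histories: object states, events and the marker `⋄`. -/
inductive Elem (E : Type)
  | st (s : State E)
  | ev (e : Event E)
  | mark

def Elem.map {E F : Type} (g : E → F) : Elem E → Elem F
  | .st s => .st (s.map g)
  | .ev e => .ev (e.map g)
  | .mark => .mark

def Elem.syms : Elem SymExpr → Set Sym
  | .st s => {x | (∃ v, x ∈ (s.loc v).syms) ∨ ∃ f, x ∈ (s.heap f).syms}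
  | .ev e => {x | ∃ a ∈ e.vals, x ∈ a.syms}
  | .mark => ∅

/-- Histories: alternating sequences of object states and events (or `⋄`). -/
abbrev Hist (E : Type) := List (Elem E)

/-- The history of semantic values, seen as a symbolic one. -/
def Hist.embed (h : Hist Value) : Hist SymExpr := h.map (Elem.map SymExpr.val)

noncomputable def Hist.subst (δ : Subst) (h : Hist SymExpr) : Hist SymExpr :=
  h.map (Elem.map (SymExpr.subst δ))

def Hist.syms (h : Hist SymExpr) : Set Sym := {x | ∃ a ∈ h, x ∈ a.syms}

/-- The part of a history before its first marker. -/
def Hist.beforeMark {E : Type} : Hist E → Hist E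
  | [] => []
  | .mark :: _ => []
  | a :: h => a :: beforeMark h

/-- The standard chop: `h'` continues `h`, which ends in the first state of `h'`. -/
def Chop {E : Type} (h h' r : Hist E) : Prop :=
  ∃ pre s post, h = pre ++ [.st s] ∧ h' = .st s :: post ∧ r = pre ++ .st s :: post

/-- The extended chop, which adds a marker if only the heaps agree. -/
def MegaChop {E : Type} (h h' r : Hist E) : Prop :=
  Chop h h' r ∨ ∃ pre s s' post, h = pre ++ [.st s] ∧ h' = .st s' :: post ∧
    s.heap = s'.heap ∧ s.loc ≠ s'.loc ∧ r = pre ++ .st s :: .mark :: .st s' :: post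

/-- Local traces: a selection condition and a history. -/
structure Trace where
  sc : Set SymExpr
  hs : Hist SymExpr

noncomputable def Trace.subst (δ : Subst) (θ : Trace) : Trace :=
  ⟨SymExpr.subst δ '' θ.sc, θ.hs.subst δ⟩

/-! ### Locally abstract semantics -/

/-- The heap that maps every field to a symbolic field with counter `i` and every class parameter
according to `ρ`. -/
def idHeap (pars : List FieldName) (i : ℕ) (ρ : FieldName → SymExpr) : FieldName → SymExpr :=
  fun f => if f ∈ pars then ρ f else .sym (.field f i)

/-- The parameters of the semantics of a statement: object name, resolved future, method name and
the class parameters of the object. -/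
structure Ctx where
  self : SymExpr
  fut : SymExpr
  meth : MName
  pars : List FieldName

/-- A statement to be evaluated in a state; `k` is the next unused counter. -/
structure Config where
  k : ℕ
  stmt : Stmt
  st : State SymExpr

/-- `LStep Γ c sc h c'` says that `{ sc ∪ sc' ▷ h ∘ h' | sc' ▷ h' ∈ ⟦c'⟧ } ⊆ ⟦c⟧` is an instance of
one of the equations that define the semantics of statements. Each `h` ends just before the first
state of the traces of `c'`, so concatenation is the chop. -/
inductive LStep (Γ : Ctx) : Config → Set SymExpr → Hist SymExpr → Config → Prop
  | skip (k s st) : LStep Γ ⟨k, .seq .skip s, st⟩ ∅ [] ⟨k, s, st⟩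
  | assign (k D l e s st) :
      LStep Γ ⟨k, .seq (.assign D l e) s, st⟩ ∅ [.st st, .ev .noEv] ⟨k, s, st.set l (e.eval st)⟩
  | iteTrue (k e s s' s'' st) :
      LStep Γ ⟨k, .seq (.ite e s s') s'', st⟩ {e.eval st} [] ⟨k, .seq s s'', st⟩
  | iteFalse (k e s s' s'' st) :
      LStep Γ ⟨k, .seq (.ite e s s') s'', st⟩ {(Expr.un .not e).eval st} [] ⟨k, .seq s' s'', st⟩
  | get (k D v e i s st) :
      LStep Γ ⟨k, .seq (.get D v e i) s, st⟩ ∅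
        [.st st, .ev (.futREv Γ.self (e.eval st) (.sym (.freshMeth k)) (.sym (.fresh k)) i)]
        ⟨k + 1, s, st.setLoc v (.sym (.fresh k))⟩
  | call (k D v l m args s st) :
      LStep Γ ⟨k, .seq (.call D v l m args) s, st⟩ ∅
        [.st st, .ev (.invEv Γ.self ((Expr.loc l).eval st) (.sym (.fresh k)) m
          (args.map (Expr.eval st)))]
        ⟨k + 1, s, st.setLoc v (.sym (.fresh k))⟩
  | awaitFut (k e i s st) :
      LStep Γ ⟨k, .seq (.await (.fut e) i) s, st⟩ ∅
        [.st st, .ev (.suspEv Γ.self Γ.fut (e.eval st) i), .st st, .mark,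
          .st ⟨st.loc, idHeap Γ.pars k st.heap⟩, .ev (.suspREv Γ.self Γ.fut (e.eval st) i)]
        ⟨k + 1, s, ⟨st.loc, idHeap Γ.pars k st.heap⟩⟩
  | awaitCond (k e i s st) :
      LStep Γ ⟨k, .seq (.await (.cond e) i) s, st⟩ ∅
        [.st st, .ev (.condEv Γ.self Γ.fut e i), .st st, .mark,
          .st ⟨st.loc, idHeap Γ.pars k st.heap⟩, .ev (.condREv Γ.self Γ.fut e i)]
        ⟨k + 1, s, ⟨st.loc, idHeap Γ.pars k st.heap⟩⟩
  | while (k e s s' st) :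
      LStep Γ ⟨k, .seq (.while e s) s', st⟩ ∅ []
        ⟨k, .seq (.ite e (.seq s (.seq (.while e s) .skip)) .skip) s', st⟩
  | assoc (k s s' s'' st) :
      LStep Γ ⟨k, .seq (.seq s s') s'', st⟩ ∅ [] ⟨k, .seq s (.seq s' s''), st⟩

/-- `StmtSem Γ c θ`: the trace `θ` belongs to the semantics of the statement of `c`. -/
inductive StmtSem (Γ : Ctx) : Config → Trace → Prop
  | skip (k st) : StmtSem Γ ⟨k, .skip, st⟩ ⟨∅, [.st st]⟩
  | ret (k e st) :
      StmtSem Γ ⟨k, .ret e, st⟩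
        ⟨∅, [.st st, .ev (.futEv Γ.self Γ.fut Γ.meth (e.eval st)), .st st]⟩
  | step {c sc h c' θ} : LStep Γ c sc h c' → StmtSem Γ c' θ →
      StmtSem Γ c ⟨sc ∪ θ.sc, h ++ θ.hs⟩

/-- `Reach Γ c sc h c'`: the traces of `c'` continue traces of `c`, with selection condition `sc`
and history `h` so far. -/
inductive Reach (Γ : Ctx) : Config → Set SymExpr → Hist SymExpr → Config → Prop
  | refl (c) : Reach Γ c ∅ [] c
  | head {c sc h c' sc' h' c''} : LStep Γ c sc h c' → Reach Γ c' sc' h' c'' →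
      Reach Γ c (sc ∪ sc') (h ++ h') c''

/-- Prepend the invocation reaction event to a trace of the method body that starts in `st`. -/
def Program.callTrace (P : Program) (m : MName) (X f : SymExpr) (st : State SymExpr)
    (sc : Set SymExpr) (h : Hist SymExpr) : Trace :=
  ⟨sc, .st st :: .ev (.invREv X f m ((P.paramNames m).map st.loc)) :: h⟩

/-- The semantics of a method. -/
def Program.methSem (P : Program) (m : MName) (X f : SymExpr) (st : State SymExpr) : Set Trace :=
  {θ | ∃ C M τ, P.lookup m = some (C, M) ∧
    StmtSem ⟨X, f, m, C.parNames⟩ ⟨1, M.body, st⟩ τ ∧ θ = P.callTrace m X f st τ.sc τ.hs}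

/-! ### Agreement of processes -/

/-- Heap application: the symbolic fields that occur before the first marker are replaced. -/
noncomputable def Trace.heapSubst (ρ : FieldName → Value) (θ : Trace) : Subst := by
  classical
  exact fun x => match x with
    | .field f i => if Sym.field f i ∈ Hist.syms (Hist.beforeMark θ.hs) then some (ρ f) else none
    | _ => none

noncomputable def Trace.applyHeap (ρ : FieldName → Value) (θ : Trace) : Trace :=
  θ.subst (θ.heapSubst ρ)

/-- A trace is selectable if all expressions in its selection condition evaluate to `True`. -/
def Trace.Selectable (θ : Trace) : Prop := ∀ e ∈ θ.sc, e = .val (.bool true)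

/-- The symbolic values introduced by the first event of a trace. -/
def Trace.introduced (θ : Trace) : Set Sym :=
  match θ.hs with
  | _ :: .ev e :: _ => e.introduced
  | _ => ∅

/-- `θC` is the `ρ`-selection candidate of `θ`. -/
def Trace.IsCandidate (ρ : FieldName → Value) (θ θC : Trace) : Prop :=
  ∃ s e s' rest, (θ.applyHeap ρ).hs = .st s :: .ev e :: .st s' :: rest ∧
    θC.hs = [.st s, .ev e, .st s'] ∧ Hist.syms θC.hs ⊆ e.introduced ∧
    θC.sc = {c ∈ (θ.applyHeap ρ).sc | c.syms ⊆ e.introduced}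

open Classical in
/-- The substitution of the symbolic values introduced by the first event of `θ` by the values
that `δ` gives. -/
noncomputable def Trace.valSubst (δ : Sym → Value) (θ : Trace) : Subst :=
  fun x => if x ∈ θ.introduced then some (δ x) else none

/-- The `ρ`-selection candidate of `θ` is selected under `δ`. -/
def Trace.Selected (ρ : FieldName → Value) (δ : Sym → Value) (θ : Trace) : Prop :=
  ∃ θC, θ.IsCandidate ρ θC ∧ (θC.subst (θC.valSubst δ)).Selectable

/-- Drop the first state of a history, if it is followed by a marker, and that marker. -/
def Hist.dropMark {E : Type} : Hist E → Hist E
  | .st _ :: .mark :: h => h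
  | h => h

/-- `θ'` is what remains of `θ` after the heap `ρ` and the values `δ` are substituted and the
first step is removed. -/
def Trace.Remainder (ρ : FieldName → Value) (δ : Sym → Value) (θ θ' : Trace) : Prop :=
  ∃ s e rest,
    ((θ.applyHeap ρ).subst ((θ.applyHeap ρ).valSubst δ)).hs = .st s :: .ev e :: rest ∧
    θ' = ⟨((θ.applyHeap ρ).subst ((θ.applyHeap ρ).valSubst δ)).sc, Hist.dropMark rest⟩

/-- The data of an agreement: the traces of the process, the heap, the values of the introduced
symbolic values, the agreed step `⟨pre, ev, post⟩` and the continuation. -/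
structure Agreement where
  proc : Set Trace
  heap : FieldName → Value
  δ : Sym → Value
  pre : State Value
  ev : Event Value
  post : State Value
  cont : Set Trace

/-- The history of the agreed trace. -/
def Agreement.hist (A : Agreement) : Hist Value := [.st A.pre, .ev A.ev, .st A.post]

/-- The process agrees: every trace has a candidate, some candidate is selected, and all selected
candidates are equal to the agreed, fully concrete step. The continuation consists of the
remainders of the traces that are selected; a finished trace leaves no remainder. -/
def Agreement.Valid (A : Agreement) : Prop :=
  (∀ θ ∈ A.proc, ∃ θC, θ.IsCandidate A.heap θC) ∧
  (∃ θ ∈ A.proc, θ.Selected A.heap A.δ) ∧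
  (∀ θ ∈ A.proc, ∀ θC, θ.IsCandidate A.heap θC → (θC.subst (θC.valSubst A.δ)).Selectable →
    (θC.subst (θC.valSubst A.δ)).hs = Hist.embed A.hist) ∧
  A.cont = {θ' | 1 < θ'.hs.length ∧
    ∃ θ ∈ A.proc, θ.Selected A.heap A.δ ∧ θ.Remainder A.heap A.δ θ'}

/-! ### Globally concrete semantics -/

/-- Objects: process pool, object trace (it has no selection condition) and active process. -/
structure Obj where
  pool : Multiset (Set Trace)
  trace : Hist Value
  active : Set Trace

def lastState (h : Hist Value) : Option (State Value) :=
  match h.getLast? with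
  | some (.st s) => some s
  | _ => none

inductive ObjStep : Obj → Agreement → Obj → Prop
  | schedule {A : Agreement} {pool tr s tr'} :
      lastState tr = some s → A.Valid → A.heap = s.heap → ¬ A.ev.Suspends →
      MegaChop tr A.hist tr' → ObjStep ⟨A.proc ::ₘ pool, tr, ∅⟩ A ⟨pool, tr', A.cont⟩
  | step {A : Agreement} {pool tr s tr'} :
      lastState tr = some s → A.Valid → A.heap = s.heap → ¬ A.ev.Suspends →
      Chop tr A.hist tr' → ObjStep ⟨pool, tr, A.proc⟩ A ⟨pool, tr', A.cont⟩
  | deschedule {A : Agreement} {pool tr s tr'} :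
      lastState tr = some s → A.Valid → A.heap = s.heap → A.ev.Suspends →
      Chop tr A.hist tr' → ObjStep ⟨pool, tr, A.proc⟩ A ⟨A.cont ::ₘ pool, tr', ∅⟩

/-- The initial local state of a method: arguments for its parameters, defaults for the declared
variables. -/
def Program.initLoc (P : Program) (m : MName) (args : List Value) : VarName → Value := fun v =>
  match ((P.paramNames m).zip args).lookup v with
  | some a => a
  | none => match P.lookup m with
    | some (_, M) => match M.body.decls.lookup v with
      | some D => D.default
      | none => .unit
    | none => .unit

/-- Rule O-Add: the object `X` of class `C` adds a process for a call of the method `m` on the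
future `n` to its pool. -/
def ObjAdd (P : Program) (X : ℕ) (C : ClassName) (n : ℕ) (m : MName) (args : List Value)
    (O : Obj) (Θ : Set Trace) (O' : Obj) : Prop :=
  ∃ D M s, P.lookup m = some (D, M) ∧ m.cls = C ∧ args.length = M.params.length ∧
    lastState O.trace = some s ∧
    Θ = P.methSem m (.val (.obj X)) (.val (.fut (some n)))
      ⟨fun v => .val (P.initLoc m args v), idHeap D.parNames 0 (fun f => .val (s.heap f))⟩ ∧
    O' = ⟨Θ ::ₘ O.pool, O.trace, O.active⟩

/-- Systems: the global sequence of events and the objects. -/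
structure Sys (P : Program) where
  evs : List (Event Value)
  objs : Fin P.objects.length → Obj

/-- A label of a step of a system: the agreement and, for a call, the added process. -/
structure StepLabel where
  agr : Agreement
  spawn : Option (MName × Set Trace)

inductive SysStep (P : Program) : Sys P → StepLabel → Sys P → Prop
  | internal {S : Sys P} {i A O'} : ObjStep (S.objs i) A O' → ¬ A.ev.IsInv → ¬ A.ev.IsFutR →
      SysStep P S ⟨A, none⟩ ⟨S.evs ++ [A.ev], Function.update S.objs i O'⟩
  | get {S : Sys P} {i A O' X f m v n X'} : ObjStep (S.objs i) A O' →
      A.ev = .futREv X f (.meth m) v n → Event.futEv X' f m v ∈ S.evs →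
      SysStep P S ⟨A, none⟩ ⟨S.evs ++ [A.ev], Function.update S.objs i O'⟩
  | invoc {S : Sys P} {i j A O' n m args Θ O''} : i ≠ j → ObjStep (S.objs i) A O' →
      A.ev = .invEv (.obj i) (.obj j) (.fut (some n)) m args →
      (∀ e ∈ S.evs, ∀ v ∈ e.vals, ¬ v.HasFut n) →
      ObjAdd P j (P.objects.get j).cls n m args (S.objs j) Θ O'' →
      SysStep P S ⟨A, some (m, Θ)⟩
        ⟨S.evs ++ [A.ev], Function.update (Function.update S.objs i O') j O''⟩

inductive Run (P : Program) : Sys P → List StepLabel → Sys P → Prop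
  | nil (S) : Run P S [] S
  | cons {S l S' ls S''} : SysStep P S l S' → Run P S' ls S'' → Run P S (l :: ls) S''

/-- All process pools are empty and no process is active. -/
def Sys.Terminated {P : Program} (S : Sys P) : Prop :=
  ∀ i, (S.objs i).pool = 0 ∧ (S.objs i).active = ∅

/-- The value of a variable of the main block. -/
def Program.mainVar (P : Program) (v : VarName) : Value :=
  match P.objects.findIdx? (fun o => o.var = v) with
  | some i => .obj i
  | none => .unit

/-- The initial value of a field: its initializer where there is one that evaluates to a semantic
value, and the default value of its data type otherwise. -/
noncomputable def FieldDecl.initVal (d : FieldDecl) : Value :=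
  match d.initial with
  | none => d.type.default
  | some e => match e.eval ⟨fun _ => .val .unit, fun _ => .val .unit⟩ with
    | .val v => v
    | _ => d.type.default

/-- The initial heap of an object: the class parameters as given by its creation, and the fields
with their initial values. -/
noncomputable def Program.initHeap (P : Program) (o : Creation) : FieldName → Value := fun f =>
  match P.findClass o.cls with
  | none => .unit
  | some C => match (C.parNames.zip o.args).lookup f with
    | some v => P.mainVar v
    | none => match C.fields.find? (fun d => d.name = f) with
      | some d => d.initVal
      | none => .unit

/-- `S` is an initial system of `P`, and `Θ` is the process of the call in the main block. -/
def IsInitial (P : Program) (S : Sys P) (Θ : Set Trace) : Prop :=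
  ∃ (j : Fin P.objects.length) (n : ℕ) (args : List Value) (D : ClassDecl) (M : MethDecl),
    P.mainVar P.callTarget = .obj j ∧ P.lookup P.callMeth = some (D, M) ∧
    P.callMeth.cls = (P.objects.get j).cls ∧ args.length = M.params.length ∧
    P.callArgs.map (Expr.eval ⟨fun v => .val (P.mainVar v), fun _ => .val .unit⟩) =
      args.map SymExpr.val ∧
    Θ = P.methSem P.callMeth (.val (.obj j)) (.val (.fut (some n)))
      ⟨fun v => .val (P.initLoc P.callMeth args v),
        fun f => .val (P.initHeap (P.objects.get j) f)⟩ ∧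
    S.evs = [] ∧
    S.objs j = ⟨{Θ}, [.st ⟨P.initLoc P.callMeth args, P.initHeap (P.objects.get j)⟩], ∅⟩ ∧
    ∀ i, i ≠ j → S.objs i = ⟨0, [.st ⟨fun _ => .unit, P.initHeap (P.objects.get i)⟩], ∅⟩

/-! ### Selected traces -/

/-- The fully symbolic state in which a method of a class with parameters `pars` is started. -/
def symState (pars : List FieldName) : State SymExpr :=
  ⟨fun v => .sym (.loc v), idHeap pars 0 (fun p => .sym (.cparam p))⟩

/-- The traces of a method in every possible context. -/
def Program.symSem (P : Program) (m : MName) : Set Trace :=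
  {θ | ∃ C M, P.lookup m = some (C, M) ∧
    θ ∈ P.methSem m (.sym .self) (.sym .fut) (symState C.parNames)}

/-- The concretizer contains the substitutions that `θ` undergoes in an agreement. -/
def Concretizer.Records (χ : Concretizer) (A : Agreement) (θ : Trace) : Prop :=
  (∀ x v, θ.heapSubst A.heap x = some v → χ x = v) ∧
  ∀ x ∈ (θ.applyHeap A.heap).introduced, χ x = A.δ x

/-- `Follows As χ θ`: by agreements from `As`, the trace `θ` of a process is selected step by step
until it is finished, and `χ` records the substitutions on the way. -/
inductive Follows (As : List Agreement) (χ : Concretizer) : Trace → Prop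
  | last {A θ θ'} : A ∈ As → θ ∈ A.proc → θ.Selected A.heap A.δ → χ.Records A θ →
      θ.Remainder A.heap A.δ θ' → θ'.hs.length = 1 → Follows As χ θ
  | step {A θ θ'} : A ∈ As → θ ∈ A.proc → θ.Selected A.heap A.δ → χ.Records A θ →
      θ.Remainder A.heap A.δ θ' → 1 < θ'.hs.length → Follows As χ θ' → Follows As χ θ

/-- `θ` is selected as `θχ` in `P`: `χ` is a concretizer of the fully symbolic trace `θ` of `m`
that is used in some terminating run. The run starts a process of `m` with a trace `θ'` that
results from `θ` by a part of `χ` (the initial continuation), and `θ'` is followed to its end. -/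
def SelectedTrace (P : Program) (m : MName) (θ : Trace) (χ : Concretizer) : Prop :=
  θ ∈ P.symSem m ∧ ∃ S Θ₀ ls S', IsInitial P S Θ₀ ∧ Run P S ls S' ∧ S'.Terminated ∧
    ∃ Θ, (m, Θ) ∈ (P.callMeth, Θ₀) :: ls.filterMap StepLabel.spawn ∧
    ∃ θ' ∈ Θ, ∃ δ : Subst, (∀ x v, δ x = some v → χ x = v) ∧ θ.subst δ = θ' ∧
      Follows (ls.map StepLabel.agr) χ θ'

/-- The history `h` is the concretization of `θ` by `χ`. -/
def Concretizes (χ : Concretizer) (θ : Trace) (h : Hist Value) : Prop :=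
  θ.hs.subst χ.toSubst = Hist.embed h

/-- `τ` is the part of the trace `θ` of `m` that is generated by the statement `s`. -/
def ContinuesWith (P : Program) (m : MName) (θ : Trace) (s : Stmt) (τ : Trace) : Prop :=
  ∃ C M sc h k st, P.lookup m = some (C, M) ∧
    Reach ⟨.sym .self, .sym .fut, m, C.parNames⟩ ⟨1, M.body, symState C.parNames⟩ sc h
      ⟨k, s, st⟩ ∧
    StmtSem ⟨.sym .self, .sym .fut, m, C.parNames⟩ ⟨k, s, st⟩ τ ∧
    θ = P.callTrace m (.sym .self) (.sym .fut) (symState C.parNames) (sc ∪ τ.sc) (h ++ τ.hs)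

/-- The selected traces of the statement `s` of method `m` that start in the state `s₀`:
the continuations of selected traces of `m` that start with `s` and `s₀`. -/
def selectedTraces (P : Program) (m : MName) (s : Stmt) (s₀ : State Value) : Set (Hist Value) :=
  {h | ∃ θ χ τ, SelectedTrace P m θ χ ∧ ContinuesWith P m θ s τ ∧ Concretizes χ τ h ∧
    h.head? = some (.st s₀)}

/-! ### First-order state logic -/

/-- Logical values: semantic values, heaps and field names. -/
inductive LVal
  | val (v : Value)
  | heap (h : FieldName → Value)
  | fld (f : FieldName)

inductive FunSym
  | num (n : ℕ)
  | never | nil | true | false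
  | un (o : UnOp)
  | bin (o : BinOp)
  | index | select | store | anon
  | user (n : ℕ)

/-- The natural meaning of the function symbols, where it is defined (`t[i]` counts from 1).
Nothing is prescribed for `anon` and user-defined symbols. -/
noncomputable def FunSym.natural : FunSym → List LVal → Option LVal
  | .num n, [] => some (.val (.num n))
  | .never, [] => some (.val (.fut none))
  | .nil, [] => some (.val (.list []))
  | .true, [] => some (.val (.bool Bool.true))
  | .false, [] => some (.val (.bool Bool.false))
  | .un o, [.val v] => (o.eval v).map LVal.val
  | .bin o, [.val v, .val w] => (o.eval v w).map LVal.val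
  | .index, [.val (.list l), .val (.num q)] =>
      if q.den = 1 ∧ 1 ≤ q then (l[q.num.toNat - 1]?).map LVal.val else none
  | .select, [.heap h, .fld f] => some (.val (h f))
  | .store, [.heap h, .fld f, .val v] => some (.heap (Function.update h f v))
  | _, _ => none

/-- Interpretations: `fn` interprets function symbols where no natural meaning is prescribed, and
`pred` interprets predicate symbols. -/
structure Interp where
  fn : FunSym → List LVal → LVal
  pred : ℕ → List LVal → Prop

noncomputable def Interp.apply (I : Interp) (f : FunSym) (as : List LVal) : LVal :=
  (f.natural as).getD (I.fn f as)

/-- Terms; `const` stands for a logical variable with a fixed value. -/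
inductive FTerm
  | lvar (x : ℕ)
  | const (a : LVal)
  | var (v : VarName)
  | heap
  | field (f : FieldName)
  | app (f : FunSym) (n : ℕ) (args : Fin n → FTerm)

/-- Sorts: data types, class names, natural numbers and heaps. -/
inductive FSort
  | ty (D : Ty)
  | cls (C : ClassName)
  | nat
  | heap

def FSort.carrier (P : Program) : FSort → Set LVal
  | .ty D => {a | ∃ v ∈ D.values, a = .val v}
  | .cls C => {a | ∃ i : Fin P.objects.length, (P.objects.get i).cls = C ∧ a = .val (.obj i)}
  | .nat => {a | ∃ n : ℕ, a = .val (.num n)}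
  | .heap => {a | ∃ h, a = .heap h}

inductive FOS
  | pred (p : ℕ) (n : ℕ) (args : Fin n → FTerm)
  | eq (t t' : FTerm)
  | or (φ φ' : FOS)
  | not (φ : FOS)
  | ex (x : ℕ) (S : FSort) (φ : FOS)

noncomputable def FTerm.eval (I : Interp) (β : ℕ → LVal) (s : State Value) : FTerm → LVal
  | .lvar x => β x
  | .const a => a
  | .var v => .val (s.loc v)
  | .heap => .heap s.heap
  | .field f => .fld f
  | .app f _ args => I.apply f (List.ofFn fun i => (args i).eval I β s)

/-- The satisfaction relation of state formulas. -/
def FOS.Sat (P : Program) (I : Interp) : (ℕ → LVal) → State Value → FOS → Prop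
  | β, s, .pred p _ args => I.pred p (List.ofFn fun i => (args i).eval I β s)
  | β, s, .eq t t' => t.eval I β s = t'.eval I β s
  | β, s, .or φ φ' => FOS.Sat P I β s φ ∨ FOS.Sat P I β s φ'
  | β, s, .not φ => ¬ FOS.Sat P I β s φ
  | β, s, .ex x S φ => ∃ a ∈ S.carrier P, FOS.Sat P I (Function.update β x a) s φ

/-- Replacement of program variables by values. -/
def FTerm.subst (r : VarName → Option Value) : FTerm → FTerm
  | .var v => match r v with
    | some a => .const (.val a)
    | none => .var v
  | .app f n args => .app f n fun i => (args i).subst r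
  | t => t

def FOS.subst (r : VarName → Option Value) : FOS → FOS
  | .pred p n args => .pred p n fun i => (args i).subst r
  | .eq t t' => .eq (t.subst r) (t'.subst r)
  | .or φ φ' => .or (φ.subst r) (φ'.subst r)
  | .not φ => .not (φ.subst r)
  | .ex x S φ => .ex x S (φ.subst r)

/-- All program variables of the term are in `V`; in particular, `heap` does not occur. -/
def FTerm.OnlyVars (V : Set VarName) : FTerm → Prop
  | .var v => v ∈ V
  | .heap => False
  | .app _ _ args => ∀ i, (args i).OnlyVars V
  | _ => True

def FOS.OnlyVars (V : Set VarName) : FOS → Prop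
  | .pred _ _ args => ∀ i, (args i).OnlyVars V
  | .eq t t' => t.OnlyVars V ∧ t'.OnlyVars V
  | .or φ φ' => φ.OnlyVars V ∧ φ'.OnlyVars V
  | .not φ => φ.OnlyVars V
  | .ex _ _ φ => φ.OnlyVars V

/-- The formula `true`. -/
def FOS.tt : FOS := .eq .heap .heap

/-- The field `f` of the current object has the value `v`: `select(heap, f) ≐ v`. -/
def FOS.fieldEq (f : FieldName) (v : Value) : FOS :=
  .eq (.app .select 2 ![.heap, .field f]) (.const (.val v))

/-! ### Monadic second-order trace logic -/

/-- Sorts of quantified elements other than trace positions. -/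
inductive MSort
  | obj | fut | meth | any | anyList | nat

def MSort.Carrier : MSort → Type
  | .obj => ℕ
  | .fut => Option ℕ
  | .meth => MName
  | .any => Value
  | .anyList => List Value
  | .nat => ℕ

/-- Trace formulas. Binders are represented by functions, so that all bound variables are
automatically distinct. `exPos` and `exSet` quantify over the sort of trace positions and its
subsets. -/
inductive MSO
  | pred (p : ℕ) (args : List LVal)
  | isEvent (i : ℕ)
  | isState (i : ℕ)
  | le (i j : ℕ)
  | eqMeth (m m' : MName)
  | subset (X Y : Set ℕ)
  | evAt (i : ℕ) (e : Event Value)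
  | markAt (i : ℕ)
  | stAt (i : ℕ) (φ : FOS)
  | or (ψ ψ' : MSO)
  | not (ψ : MSO)
  | exPos (F : ℕ → MSO)
  | exSet (F : Set ℕ → MSO)
  | ex (S : MSort) (F : S.Carrier → MSO)

namespace MSO

def and (ψ ψ' : MSO) : MSO := .not (.or (.not ψ) (.not ψ'))
def imp (ψ ψ' : MSO) : MSO := .or (.not ψ) ψ'
def allPos (F : ℕ → MSO) : MSO := .not (.exPos fun i => .not (F i))
def lt (i j : ℕ) : MSO := .not (.le j i)
def eqPos (i j : ℕ) : MSO := and (.le i j) (.le j i)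
def mem (i : ℕ) (X : Set ℕ) : MSO := .subset {i} X
def fls : MSO := lt 0 0

/-- Finite disjunction. -/
def disj : List MSO → MSO
  | [] => fls
  | ψ :: l => .or ψ (disj l)

/-- Relativization of the sort of positions to those that satisfy `g`. -/
def rel (g : ℕ → MSO) : MSO → MSO
  | .or ψ ψ' => .or (rel g ψ) (rel g ψ')
  | .not ψ => .not (rel g ψ)
  | .exPos F => .exPos fun i => and (g i) (rel g (F i))
  | .exSet F => .exSet fun X =>
      and (allPos fun i => imp (mem i X) (g i)) (rel g (F X))
  | .ex S F => .ex S fun a => rel g (F a)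
  | ψ => ψ

/-- The element at position `i` of a history; positions start with 1. -/
def elemAt (h : Hist Value) (i : ℕ) : Option (Elem Value) := if i = 0 then none else h[i - 1]?

/-- The satisfaction relation of trace formulas; the positions of `h` are `1, …, |h|`. -/
def Sat (P : Program) (I : Interp) (β : ℕ → LVal) (h : Hist Value) : MSO → Prop
  | .pred p args => I.pred p args
  | .isEvent i => (∃ e, elemAt h i = some (.ev e)) ∨ elemAt h i = some .mark
  | .isState i => ∃ s, elemAt h i = some (.st s)
  | .le i j => i ≤ j
  | .eqMeth m m' => m = m'
  | .subset X Y => X ⊆ Y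
  | .evAt i e => elemAt h i = some (.ev e)
  | .markAt i => elemAt h i = some .mark
  | .stAt i φ => ∃ s, elemAt h i = some (.st s) ∧ φ.Sat P I β s
  | .or ψ ψ' => Sat P I β h ψ ∨ Sat P I β h ψ'
  | .not ψ => ¬ Sat P I β h ψ
  | .exPos F => ∃ i, 1 ≤ i ∧ i ≤ h.length ∧ Sat P I β h (F i)
  | .exSet F => ∃ X : Set ℕ, (∀ i ∈ X, 1 ≤ i ∧ i ≤ h.length) ∧ Sat P I β h (F X)
  | .ex _ F => ∃ a, Sat P I β h (F a)

end MSO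

/-! ### Method types -/

/-- Method types: call action `X!m(φ)`, termination `↓(φ)`, `skip`, sequence, repetition, active
choice over a non-empty finite index set, and passive choice. -/
inductive MType
  | call (X : ℕ) (m : MName) (φ : FOS)
  | ret (φ : FOS)
  | skip
  | seq (L L' : MType)
  | star (L : MType)
  | oplus (n : ℕ) (Ls : Fin (n + 1) → MType)
  | amp (ms : List MName) (φ : FOS) (L L' : MType)

open MSO in
/-- Position `i` is the only one with an event other than `noEv`. -/
def onlyEventAt (i : ℕ) : MSO :=
  allPos fun j => imp (and (.isEvent j) (.not (.evAt j .noEv))) (eqPos j i)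

open MSO in
/-- The translation of method types, for an assignment `ω` of objects to roles. -/
def MType.transl (P : Program) (ω : ℕ → ℕ) : MType → MSO
  | .call X m φ =>
      .ex .obj fun x : ℕ => .ex .fut fun f : Option ℕ => .ex .anyList fun es : List Value =>
        .exPos fun i =>
          and (and (.evAt i (.invEv (.obj x) (.obj (ω X)) (.fut f) m es))
            (.stAt (i - 1) (φ.subst fun v => ((P.paramNames m).zip es).lookup v)))
          (onlyEventAt i)
  | .ret φ =>
      .ex .obj fun x : ℕ => .ex .fut fun f : Option ℕ => .ex .meth fun m : MName =>
        .ex .any fun e : Value => .exPos fun i =>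
          and (and (.evAt i (.futEv (.obj x) (.fut f) m e))
            (.stAt (i - 1) (φ.subst fun v => if v = .result then some e else none)))
          (onlyEventAt i)
  | .skip => allPos fun l => .or (.evAt l .noEv) (.stAt l .tt)
  | .seq L L' => .exPos fun i => and (.isState i)
      (and (rel (fun n => .le n i) (L.transl P ω)) (rel (fun n => .le i n) (L'.transl P ω)))
  | .star L => .exSet fun J => .exPos fun a => .exPos fun b =>
      and (and (mem a J) (mem b J))
        (and (allPos fun k => imp (mem k J) (.isState k))
          (and
            (allPos fun k => .or (and (lt k a) (imp (.isEvent k) (.evAt k .noEv)))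
              (and (.le a k) (.le k b)))
            (allPos fun i => allPos fun j =>
              imp (and (and (mem i J) (mem j J))
                (and (lt i j) (allPos fun l => imp (mem l J) (.or (.le l i) (.le j l)))))
                (rel (fun n => and (.le i n) (.le n j)) (L.transl P ω)))))
  | .oplus _ Ls => disj (List.ofFn fun i => (Ls i).transl P ω)
  | .amp ms φ L L' =>
      .ex .obj fun x : ℕ => .ex .fut fun f : Option ℕ => .ex .meth fun m : MName =>
        .ex .any fun e : Value => .ex .nat fun n : ℕ =>
          .exPos fun i => .exPos fun j => .exPos fun k =>
            and (and (lt i j) (lt j k))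
              (and (and
                (allPos fun l => .or (eqPos l j) (.or (.le k l)
                  (and (.le l i) (.or (.evAt l .noEv) (.stAt l .tt)))))
                (and (.evAt j (.futREv (.obj x) (.fut f) (.meth m) e n))
                  (disj (ms.map fun m' => .eqMeth m m'))))
              (and
                (imp (.stAt k (φ.subst fun v => if v = .result then some e else none))
                  (rel (fun n => .le k n) (L.transl P ω)))
                (imp (.not (.stAt k (φ.subst fun v => if v = .result then some e else none)))
                  (rel (fun n => .le k n) (L'.transl P ω)))))

open MSO in
/-- The translation `α_met`: there are objects for the roles, which are stored in the fields
that are assigned to the roles, such that the translation of the type holds. -/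
def alphaMet (P : Program) (L : MType) : List (ℕ × FieldName) → (ℕ → ℕ) → MSO
  | [], ω => L.transl P ω
  | (X, f) :: rs, ω => .ex .obj fun o : ℕ =>
      and (.stAt 1 (.fieldEq f (.obj o))) (alphaMet P L rs (Function.update ω X o))

/-- The call action `X!m(φ)` occurs in a method type, for some role `X`. -/
inductive MType.Calls (m : MName) (φ : FOS) : MType → Prop
  | call (X) : Calls m φ (.call X m φ)
  | seqL {L L'} : Calls m φ L → Calls m φ (.seq L L')
  | seqR {L L'} : Calls m φ L' → Calls m φ (.seq L L')
  | star {L} : Calls m φ L → Calls m φ (.star L)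
  | oplus {n Ls} (i : Fin (n + 1)) : Calls m φ (Ls i) → Calls m φ (.oplus n Ls)
  | ampL {ms ψ L L'} : Calls m φ L → Calls m φ (.amp ms ψ L L')
  | ampR {ms ψ L L'} : Calls m φ L' → Calls m φ (.amp ms ψ L L')

/-- The local protocol `?m(pre).type` of a method, with the fields that are assigned to its
roles. -/
structure Protocol where
  pre : FOS
  type : MType
  roles : List (ℕ × FieldName)

/-- The trace formula `α_met(L)` of a protocol. -/
def Protocol.formula (P : Program) (p : Protocol) : MSO := alphaMet P p.type p.roles (fun _ => 0)

/-- The state `s₀` satisfies the behavioral modality `[s ⇝ ψ]` in method `m`: all selected traces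
of `s` that start in `s₀` are models of the trace formula `ψ`. -/
def ModalitySat (P : Program) (I : Interp) (m : MName) (β : ℕ → LVal) (s₀ : State Value)
    (s : Stmt) (ψ : MSO) : Prop :=
  ∀ h ∈ selectedTraces P m s s₀, ψ.Sat P I β h

/-- The proof obligation `φ ⇒ [s ⇝ ψ]` is valid. -/
def ObligationValid (P : Program) (I : Interp) (m : MName) (φ : FOS) (s : Stmt) (ψ : MSO) : Prop :=
  ∀ (s₀ : State Value) (β : ℕ → LVal), φ.Sat P I β s₀ → ModalitySat P I m β s₀ s ψ

/-- Preconditions are predicates on the parameters of the method. -/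
def ParameterPreconditions (P : Program) (T : MName → Protocol) : Prop :=
  ∀ m C M, P.lookup m = some (C, M) → (T m).pre.OnlyVars {v | v ∈ P.paramNames m}

/-- Consistency of an obligation scheme: call conditions imply the preconditions of the called
methods, and the precondition of the method that the main block calls is valid. -/
def Consistent (P : Program) (I : Interp) (T : MName → Protocol) : Prop :=
  (∀ m' C' M' m C M φ, P.lookup m' = some (C', M') → P.lookup m = some (C, M) →
    (T m').type.Calls m φ → ∀ β s, φ.Sat P I β s → (T m).pre.Sat P I β s) ∧
  ∀ β s, (T P.callMeth).pre.Sat P I β s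

end CAO

/-!
Two facts have to be shown for a selected trace: it becomes concrete, and its method is started in a
state that satisfies the precondition. The validity of the proof obligation does the rest
(`MeetsPre.sat_formula`).

*Concreteness.* All substitutions that a followed trace undergoes are parts of its concretizer `χ`,
and substitution evaluates operators as it goes, so a partial substitution before `χ` is absorbed by
`χ` (`Hist.subst_subst`). Each agreement makes the first step of the trace concrete, and the histories
of the semantics have a shape (`Hist.Alternates`) in which the steps up to the end cover every
element (`Follows.concretizes`).

*Preconditions.* The claim for all started processes is proved along the run. The process of the main
block meets its precondition by consistency. For a call, consider the calling process. Since
the run terminates, the calling step belongs to a trace that is followed to its end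
(`Run.exists_follows_cons`), and going back through the agreements it is the end of a trace of
the process as it was started (`Descends.exists_follows`). Different choices of concretizers on the
way are compatible, as a placeholder disappears when it is replaced. This trace is an instance of a
fully symbolic trace of the calling method (`Program.StartedWith.exists_selected`, by lifting the
semantics along substitutions), hence a selected trace. The caller was started earlier, in a state
with its precondition, so the selected trace satisfies the type of the caller. In a model of a type,
each invocation event is matched by a call action whose condition holds in the state before the event
(`MType.calls_of_satOn`). By consistency that condition implies the precondition of the called method,
which depends on the parameters only and so holds in the state in which the callee starts
(`FOS.sat_initLoc`).
-/

namespace CAO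

/-! ### Substitutions -/

theorem SymExpr.subst_mkUn (δ : Subst) (o : UnOp) (e : SymExpr) :
    (mkUn o e).subst δ = mkUn o (e.subst δ) := by
  cases e with
  | val v => cases h : o.eval v <;> simp [mkUn, subst, h]
  | _ => rfl

theorem SymExpr.subst_mkBin (δ : Subst) (o : BinOp) (e e' : SymExpr) :
    (mkBin o e e').subst δ = mkBin o (e.subst δ) (e'.subst δ) := by
  cases e with
  | val v =>
    cases e' with
    | val w => cases h : o.eval v w <;> simp [mkBin, subst, h]
    | _ => rfl
  | _ => rfl

/-- The substitution `δ` is a part of the concretizer `χ`. -/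
def Concretizer.Extends (χ : Concretizer) (δ : Subst) : Prop := ∀ x v, δ x = some v → χ x = v

/-- A part of a concretizer is absorbed by the concretizer. -/
theorem SymExpr.subst_subst {χ : Concretizer} {δ : Subst} (h : χ.Extends δ) (e : SymExpr) :
    (e.subst δ).subst χ.toSubst = e.subst χ.toSubst := by
  induction e with
  | val v => rfl
  | sym x =>
    cases hx : δ x with
    | none => simp [subst, hx]
    | some v => simp [subst, hx, Concretizer.toSubst, h x v hx]
  | un o e ih => simp only [subst, subst_mkUn, ih]
  | bin o e e' ih ih' => simp only [subst, subst_mkBin, ih, ih']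

theorem SymExpr.syms_mkUn {o : UnOp} {e : SymExpr} {x : Sym} (h : x ∈ (mkUn o e).syms) :
    x ∈ e.syms := by
  cases e with
  | val v =>
    cases h' : o.eval v <;> simp [mkUn, h', syms] at h
  | _ => exact h

theorem SymExpr.syms_mkBin {o : BinOp} {e e' : SymExpr} {x : Sym} (h : x ∈ (mkBin o e e').syms) :
    x ∈ e.syms ∪ e'.syms := by
  cases e with
  | val v =>
    cases e' with
    | val w => cases h' : o.eval v w <;> simp [mkBin, h', syms] at h
    | _ => exact h
  | _ => exact h

/-- A substitution removes the placeholders that it replaces and introduces no new ones. -/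
theorem SymExpr.syms_subst {δ : Subst} {e : SymExpr} {x : Sym} (h : x ∈ (e.subst δ).syms) :
    x ∈ e.syms ∧ δ x = none := by
  induction e with
  | val v => exact absurd h (by simp [subst, syms])
  | sym y =>
    cases hy : δ y with
    | none =>
      simp only [subst, hy, syms, Set.mem_singleton_iff] at h
      subst h
      exact ⟨rfl, hy⟩
    | some v => simp [subst, hy, syms] at h
  | un o e ih => exact ih (syms_mkUn h)
  | bin o e e' ih ih' =>
    rcases syms_mkBin h with h | h
    · exact ⟨.inl (ih h).1, (ih h).2⟩
    · exact ⟨.inr (ih' h).1, (ih' h).2⟩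

theorem SymExpr.subst_congr {δ δ' : Subst} {e : SymExpr} (h : ∀ x ∈ e.syms, δ x = δ' x) :
    e.subst δ = e.subst δ' := by
  induction e with
  | val v => rfl
  | sym x => simp only [subst, h x rfl]
  | un o e ih => simp only [subst, ih h]
  | bin o e e' ih ih' =>
    simp only [subst, ih fun x hx => h x (.inl hx), ih' fun x hx => h x (.inr hx)]

theorem Expr.eval_subst (δ : Subst) (s : State SymExpr) (e : Expr) :
    (e.eval s).subst δ = e.eval (s.map (SymExpr.subst δ)) := by
  induction e with
  | loc l => cases l <;> rfl
  | un o e ih => simp only [eval, SymExpr.subst_mkUn, ih]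
  | bin o e e' ih ih' => simp only [eval, SymExpr.subst_mkBin, ih, ih']
  | _ => rfl

theorem Event.map_map {E F G : Type} (g : F → G) (f : E → F) (e : Event E) :
    (e.map f).map g = e.map (g ∘ f) := by
  cases e <;> simp [Event.map]

theorem Elem.map_map {E F G : Type} (g : F → G) (f : E → F) (a : Elem E) :
    (a.map f).map g = a.map (g ∘ f) := by
  cases a <;> simp [Elem.map, Event.map_map, State.map]

theorem Event.map_congr {E F : Type} {g g' : E → F} {e : Event E}
    (h : ∀ a ∈ e.vals, g a = g' a) : e.map g = e.map g' := by
  cases e <;> simp_all [Event.map, Event.vals]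

theorem Event.vals_map {E F : Type} (g : E → F) (e : Event E) :
    (e.map g).vals = e.vals.map g := by
  cases e <;> simp [Event.map, Event.vals]

theorem Elem.syms_subst {δ : Subst} {a : Elem SymExpr} {x : Sym}
    (h : x ∈ (a.map (SymExpr.subst δ)).syms) : x ∈ a.syms ∧ δ x = none := by
  cases a with
  | st s =>
    rcases h with ⟨v, h⟩ | ⟨f, h⟩
    · exact ⟨.inl ⟨v, (SymExpr.syms_subst h).1⟩, (SymExpr.syms_subst h).2⟩
    · exact ⟨.inr ⟨f, (SymExpr.syms_subst h).1⟩, (SymExpr.syms_subst h).2⟩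
  | ev e =>
    obtain ⟨b, hb, h⟩ := h
    rw [Event.vals_map, List.mem_map] at hb
    obtain ⟨c, hc, rfl⟩ := hb
    exact ⟨⟨c, hc, (SymExpr.syms_subst h).1⟩, (SymExpr.syms_subst h).2⟩
  | mark => exact absurd h (by simp [Elem.map, Elem.syms])

theorem Elem.subst_congr {δ δ' : Subst} {a : Elem SymExpr} (h : ∀ x ∈ a.syms, δ x = δ' x) :
    a.map (SymExpr.subst δ) = a.map (SymExpr.subst δ') := by
  cases a with
  | st s =>
    have h₁ : ∀ v, (s.loc v).subst δ = (s.loc v).subst δ' :=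
      fun v => SymExpr.subst_congr fun x hx => h x (.inl ⟨v, hx⟩)
    have h₂ : ∀ f, (s.heap f).subst δ = (s.heap f).subst δ' :=
      fun f => SymExpr.subst_congr fun x hx => h x (.inr ⟨f, hx⟩)
    simp only [Elem.map, State.map, h₁, h₂]
  | ev e =>
    exact congrArg Elem.ev (Event.map_congr fun b hb =>
      SymExpr.subst_congr fun x hx => h x ⟨b, hb, hx⟩)
  | mark => rfl

theorem Hist.syms_subst {δ : Subst} {h : Hist SymExpr} {x : Sym} (hx : x ∈ (h.subst δ).syms) :
    x ∈ h.syms ∧ δ x = none := by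
  obtain ⟨a, ha, hx⟩ := hx
  obtain ⟨b, hb, rfl⟩ := List.mem_map.1 ha
  exact ⟨⟨b, hb, (Elem.syms_subst hx).1⟩, (Elem.syms_subst hx).2⟩

theorem Hist.subst_congr {δ δ' : Subst} {h : Hist SymExpr} (hx : ∀ x ∈ h.syms, δ x = δ' x) :
    h.subst δ = h.subst δ' :=
  List.map_congr_left fun a ha => Elem.subst_congr fun x hxa => hx x ⟨a, ha, hxa⟩

theorem Hist.subst_subst {χ : Concretizer} {δ : Subst} (h : χ.Extends δ) (l : Hist SymExpr) :
    (l.subst δ).subst χ.toSubst = l.subst χ.toSubst := by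
  have hc : SymExpr.subst χ.toSubst ∘ SymExpr.subst δ = SymExpr.subst χ.toSubst :=
    funext (SymExpr.subst_subst h)
  simp only [Hist.subst, List.map_map]
  exact List.map_congr_left fun a _ => by rw [Function.comp_apply, Elem.map_map, hc]

theorem Hist.subst_embed (δ : Subst) (h : Hist Value) : (embed h).subst δ = embed h := by
  simp only [Hist.subst, Hist.embed, List.map_map]
  exact List.map_congr_left fun a _ => by
    rw [Function.comp_apply, Elem.map_map]
    rfl

theorem Hist.syms_mono {h h' : Hist SymExpr} (hs : h ⊆ h') : h.syms ⊆ h'.syms :=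
  fun _ ⟨a, ha, hx⟩ => ⟨a, hs ha, hx⟩

theorem Hist.beforeMark_subset {E : Type} (h : Hist E) : h.beforeMark ⊆ h := by
  induction h with
  | nil => simp [Hist.beforeMark]
  | cons a h ih =>
    cases a with
    | mark => simp [Hist.beforeMark]
    | _ => exact List.cons_subset_cons _ ih

theorem Hist.dropMark_suffix {E : Type} (h : Hist E) : h.dropMark <:+ h := by
  unfold Hist.dropMark
  split
  · exact ⟨[_, _], rfl⟩
  · exact List.suffix_refl _

theorem Event.introduced_subset (e : Event SymExpr) : e.introduced ⊆ (Elem.ev e).syms := by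
  intro x hx
  cases e with
  | invEv X X' f m as => exact ⟨f, by simp [Event.vals], by rw [show f = .sym x from hx]; rfl⟩
  | futREv X f m e i =>
    rcases hx with hx | hx
    · exact ⟨m, by simp [Event.vals], by rw [show m = .sym x from hx]; rfl⟩
    · exact ⟨e, by simp [Event.vals], by rw [show e = .sym x from hx]; rfl⟩
  | _ => exact absurd hx (by simp [Event.introduced])

theorem Trace.introduced_subset (θ : Trace) : θ.introduced ⊆ θ.hs.syms := by
  intro x hx
  unfold Trace.introduced at hx
  split at hx
  · rename_i a e r heq
    exact ⟨.ev e, by simp [heq], Event.introduced_subset e hx⟩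
  · exact absurd hx (by simp)

theorem Trace.heapSubst_mem {ρ : FieldName → Value} {θ : Trace} {x : Sym} {v : Value}
    (h : θ.heapSubst ρ x = some v) : x ∈ θ.hs.syms := by
  unfold Trace.heapSubst at h
  cases x with
  | field f i =>
    simp only [Option.ite_none_right_eq_some] at h
    exact Hist.syms_mono (Hist.beforeMark_subset _) h.1
  | _ => simp at h

/-! ### The shape of histories -/

/-- Histories in which every event is preceded by a state and followed by a state, the last element
is a state, and the state after a marker is followed by an event. -/
inductive Hist.Alternates {E : Type} : Hist E → Prop
  | last (s) : Alternates [.st s]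
  | event (s e) {s' r} : Alternates (.st s' :: r) → Alternates (.st s :: .ev e :: .st s' :: r)
  | mark (s e s') {s'' e' r} : Alternates (.st s'' :: .ev e' :: r) →
      Alternates (.st s :: .ev e :: .st s' :: .mark :: .st s'' :: .ev e' :: r)

theorem Hist.Alternates.map {E F : Type} (g : E → F) {h : Hist E} (H : h.Alternates) :
    Hist.Alternates (List.map (Elem.map g) h) := by
  induction H with
  | last s => exact .last _
  | event s e _ ih => exact .event _ _ ih
  | mark s e s' _ ih => exact .mark _ _ _ ih

/-- After the first step of an alternating history there is either no marker, or a marker after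
which the history does not end. -/
theorem Hist.Alternates.rest {E : Type} {s : State E} {e : Event E} {r : Hist E}
    (H : Hist.Alternates (.st s :: .ev e :: r)) :
    r.dropMark.Alternates ∧ ∃ s', (∃ r', r = .st s' :: r' ∧ r.dropMark = r) ∨
      (r = .st s' :: .mark :: r.dropMark ∧ 1 < r.dropMark.length) := by
  cases H with
  | event _ _ h =>
    cases h with
    | last s => exact ⟨.last _, _, .inl ⟨_, rfl, rfl⟩⟩
    | event s e h => exact ⟨.event _ _ h, _, .inl ⟨_, rfl, rfl⟩⟩
    | mark s e s' h => exact ⟨.mark _ _ _ h, _, .inl ⟨_, rfl, rfl⟩⟩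
  | mark _ _ s' h =>
    exact ⟨h, s', .inr ⟨rfl, by simp [Hist.dropMark]⟩⟩

theorem StmtSem.head {Γ : Ctx} {c : Config} {θ : Trace} (h : StmtSem Γ c θ) :
    ∃ r, θ.hs = .st c.st :: r := by
  induction h with
  | skip k st => exact ⟨_, rfl⟩
  | ret k e st => exact ⟨_, rfl⟩
  | step hl _ ih =>
    cases hl <;> first | exact ⟨_, rfl⟩ | exact ih

theorem StmtSem.alternates {Γ : Ctx} {c : Config} {θ : Trace} (h : StmtSem Γ c θ) :
    θ.hs.Alternates := by
  induction h with
  | skip k st => exact .last _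
  | ret k e st => exact .event _ _ (.last _)
  | step hl hs ih =>
    obtain ⟨r, hr⟩ := hs.head
    rw [hr] at ih
    cases hl <;> simp only [hr] <;>
      first | exact ih | exact .event _ _ ih | exact .mark _ _ _ (.event _ _ ih)

/-! ### Symbolic and concrete starts of a method -/

/-- The substitution leaves the placeholders alone that the execution of a method introduces. Those
have counters that start with 1; only the initial heap has the counter 0. -/
structure Subst.KeepsFresh (δ : Subst) : Prop where
  fresh : ∀ k, δ (.fresh k) = none
  freshMeth : ∀ k, δ (.freshMeth k) = none
  field : ∀ f k, 1 ≤ k → δ (.field f k) = none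

/-- Substitution in the object name and the resolved future of a context. -/
noncomputable def Ctx.subst (δ : Subst) (Γ : Ctx) : Ctx :=
  ⟨Γ.self.subst δ, Γ.fut.subst δ, Γ.meth, Γ.pars⟩

/-- Substitution in the state of a configuration. Statements contain no placeholders. -/
noncomputable def Config.subst (δ : Subst) (c : Config) : Config :=
  ⟨c.k, c.stmt, c.st.map (SymExpr.subst δ)⟩

theorem State.map_setLoc {E F : Type} (g : E → F) (s : State E) (v : VarName) (a : E) :
    (s.setLoc v a).map g = (s.map g).setLoc v (g a) := by
  simp only [State.map, State.setLoc, State.mk.injEq, and_true]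
  exact funext fun w => Function.apply_update (fun _ => g) s.loc v a w

theorem State.map_set {E F : Type} (g : E → F) (s : State E) (l : Loc) (a : E) :
    (s.set l a).map g = (s.map g).set l (g a) := by
  cases l with
  | var v => exact State.map_setLoc g s v a
  | field f =>
    simp only [State.map, State.set, State.setHeap, State.mk.injEq, true_and]
    exact funext fun w => Function.apply_update (fun _ => g) s.heap f a w

theorem idHeap_subst {δ : Subst} (hδ : δ.KeepsFresh) (pars : List FieldName) {k : ℕ} (hk : 1 ≤ k)
    (ρ : FieldName → SymExpr) :
    (fun f => (idHeap pars k ρ f).subst δ) = idHeap pars k fun f => (ρ f).subst δ := by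
  funext f
  by_cases hf : f ∈ pars <;> simp [idHeap, hf, SymExpr.subst, hδ.field f k hk]

/-- The equations of the semantics are stable under substitution: each of their instances for a
substituted configuration comes from an instance for the configuration itself. -/
theorem LStep.lift {δ : Subst} (hδ : δ.KeepsFresh) {Γ : Ctx} {c c₁ : Config} (hk : 1 ≤ c.k)
    {sc₁ : Set SymExpr} {h₁ : Hist SymExpr}
    (H : LStep (Γ.subst δ) (c.subst δ) sc₁ h₁ c₁) :
    ∃ sc h c', LStep Γ c sc h c' ∧ 1 ≤ c'.k ∧ c₁ = c'.subst δ ∧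
      sc₁ = SymExpr.subst δ '' sc ∧ h₁ = h.subst δ := by
  obtain ⟨k, stmt, st⟩ := c
  simp only at hk
  have hfr (j : ℕ) : (SymExpr.sym (.fresh j)).subst δ = .sym (.fresh j) := by
    simp [SymExpr.subst, hδ.fresh]
  have hfm (j : ℕ) : (SymExpr.sym (.freshMeth j)).subst δ = .sym (.freshMeth j) := by
    simp [SymExpr.subst, hδ.freshMeth]
  have hid := idHeap_subst hδ Γ.pars hk st.heap
  cases H with
  | skip => exact ⟨_, _, _, .skip .., hk, rfl, by simp, rfl⟩
  | assign =>
    exact ⟨_, _, _, .assign .., hk, by simp [Config.subst, State.map_set, Expr.eval_subst],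
      by simp, rfl⟩
  | iteTrue => exact ⟨_, _, _, .iteTrue .., hk, rfl, by simp [Expr.eval_subst], rfl⟩
  | iteFalse => exact ⟨_, _, _, .iteFalse .., hk, rfl, by simp [Expr.eval_subst], rfl⟩
  | get =>
    refine ⟨_, _, _, .get .., Nat.le_add_left _ _, ?_, by simp, ?_⟩
    · simp [Config.subst, State.map_setLoc, hfr]
    · simp [Hist.subst, Elem.map, Event.map, hfr, hfm, Expr.eval_subst, Ctx.subst]
  | call =>
    refine ⟨_, _, _, .call .., Nat.le_add_left _ _, ?_, by simp, ?_⟩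
    · simp [Config.subst, State.map_setLoc, hfr]
    · simp [Hist.subst, Elem.map, Event.map, hfr, Expr.eval_subst, Ctx.subst]
  | awaitFut =>
    refine ⟨_, _, _, .awaitFut .., Nat.le_add_left _ _, ?_, by simp, ?_⟩
    · simp [Config.subst, State.map, hid, Ctx.subst]
    · simp [Hist.subst, Elem.map, Event.map, Expr.eval_subst, Ctx.subst, State.map, hid]
  | awaitCond =>
    refine ⟨_, _, _, .awaitCond .., Nat.le_add_left _ _, ?_, by simp, ?_⟩
    · simp [Config.subst, State.map, hid, Ctx.subst]
    · simp [Hist.subst, Elem.map, Event.map, Ctx.subst, State.map, hid]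
  | assoc => exact ⟨_, _, _, .assoc .., hk, rfl, by simp, rfl⟩
  | _ => exact ⟨_, _, _, .while .., hk, rfl, by simp, rfl⟩

theorem StmtSem.lift {δ : Subst} (hδ : δ.KeepsFresh) {Γ : Ctx} {c : Config} (hk : 1 ≤ c.k)
    {τ : Trace} (H : StmtSem (Γ.subst δ) (c.subst δ) τ) :
    ∃ τ', StmtSem Γ c τ' ∧ τ'.subst δ = τ := by
  generalize hd : c.subst δ = d at H
  induction H generalizing c with
  | skip k st =>
    obtain ⟨k, s, st⟩ := c
    cases hd
    exact ⟨_, .skip _ _, by simp [Trace.subst, Hist.subst, Elem.map]⟩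
  | ret k e st =>
    obtain ⟨k, s, st⟩ := c
    cases hd
    exact ⟨_, .ret _ _ _, by
      simp [Trace.subst, Hist.subst, Elem.map, Event.map, Expr.eval_subst, Ctx.subst]⟩
  | step hl _ ih =>
    subst hd
    obtain ⟨sc, h, c', hl', hk', rfl, rfl, rfl⟩ := hl.lift hδ hk
    obtain ⟨τ', h', rfl⟩ := ih hk' rfl
    exact ⟨_, .step hl' h', by simp [Trace.subst, Hist.subst, Set.image_union]⟩

/-- Each trace of a method in a substituted start comes from a trace in the start itself. -/
theorem Program.methSem_lift {P : Program} {m : MName} {X f : SymExpr} {st : State SymExpr}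
    {δ : Subst} (hδ : δ.KeepsFresh) {θ : Trace}
    (h : θ ∈ P.methSem m (X.subst δ) (f.subst δ) (st.map (SymExpr.subst δ))) :
    ∃ θ' ∈ P.methSem m X f st, θ'.subst δ = θ := by
  obtain ⟨C, M, τ, hl, hτ, rfl⟩ := h
  obtain ⟨τ', hτ', rfl⟩ :=
    StmtSem.lift (Γ := ⟨X, f, m, C.parNames⟩) (c := ⟨1, M.body, st⟩) hδ le_rfl hτ
  refine ⟨_, ⟨C, M, τ', hl, hτ', rfl⟩, ?_⟩
  simp [Program.callTrace, Trace.subst, Hist.subst, Elem.map, Event.map, State.map]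

theorem Program.methSem_alternates {P : Program} {m : MName} {X f : SymExpr} {st : State SymExpr}
    {θ : Trace} (h : θ ∈ P.methSem m X f st) : θ.hs.Alternates := by
  obtain ⟨C, M, τ, hl, hτ, rfl⟩ := h
  obtain ⟨r, hr⟩ := hτ.head
  have := hτ.alternates
  simp only [Program.callTrace, hr] at this ⊢
  exact .event _ _ this

/-! ### Trace formulas -/

namespace MSO

/-- Satisfaction of a trace formula when position variables and set variables are restricted to the
positions in `D`. Atoms still refer to the whole history. -/
def SatOn (P : Program) (I : Interp) (β : ℕ → LVal) (h : Hist Value) (D : Set ℕ) : MSO → Prop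
  | .or ψ ψ' => SatOn P I β h D ψ ∨ SatOn P I β h D ψ'
  | .not ψ => ¬ SatOn P I β h D ψ
  | .exPos F => ∃ i, (1 ≤ i ∧ i ≤ h.length) ∧ i ∈ D ∧ SatOn P I β h D (F i)
  | .exSet F => ∃ X : Set ℕ, (∀ i ∈ X, (1 ≤ i ∧ i ≤ h.length) ∧ i ∈ D) ∧ SatOn P I β h D (F X)
  | .ex _ F => ∃ a, SatOn P I β h D (F a)
  | ψ => Sat P I β h ψ

variable {P : Program} {I : Interp} {β : ℕ → LVal} {h : Hist Value} {D : Set ℕ}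

theorem satOn_univ (ψ : MSO) : SatOn P I β h Set.univ ψ ↔ Sat P I β h ψ := by
  induction ψ with
  | or ψ ψ' ih ih' => simp only [SatOn, Sat, ih, ih']
  | not ψ ih => simp only [SatOn, Sat, ih]
  | exPos F ih => simp only [SatOn, Sat, ih, Set.mem_univ, true_and, and_assoc]
  | exSet F ih => simp only [SatOn, Sat, ih, Set.mem_univ, and_true]
  | ex S F ih => simp only [SatOn, Sat, ih]
  | _ => rfl

@[simp] theorem satOn_and (ψ ψ' : MSO) :
    SatOn P I β h D (and ψ ψ') ↔ SatOn P I β h D ψ ∧ SatOn P I β h D ψ' := by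
  simp only [MSO.and, SatOn]
  tauto

@[simp] theorem satOn_imp (ψ ψ' : MSO) :
    SatOn P I β h D (imp ψ ψ') ↔ (SatOn P I β h D ψ → SatOn P I β h D ψ') := by
  simp only [imp, SatOn]
  tauto

@[simp] theorem satOn_allPos (F : ℕ → MSO) :
    SatOn P I β h D (allPos F) ↔
      ∀ i, (1 ≤ i ∧ i ≤ h.length) → i ∈ D → SatOn P I β h D (F i) := by
  simp only [allPos, SatOn]
  push Not
  rfl

@[simp] theorem satOn_lt (i j : ℕ) : SatOn P I β h D (lt i j) ↔ i < j := by
  simp [lt, SatOn, Sat]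

@[simp] theorem satOn_le (i j : ℕ) : SatOn P I β h D (.le i j) ↔ i ≤ j := Iff.rfl

@[simp] theorem satOn_eqPos (i j : ℕ) : SatOn P I β h D (eqPos i j) ↔ i = j := by
  simp only [eqPos, satOn_and, satOn_le, le_antisymm_iff]

@[simp] theorem satOn_mem (i : ℕ) (X : Set ℕ) : SatOn P I β h D (mem i X) ↔ i ∈ X := by
  simp [mem, SatOn, Sat]

@[simp] theorem satOn_or (ψ ψ' : MSO) :
    SatOn P I β h D (.or ψ ψ') ↔ SatOn P I β h D ψ ∨ SatOn P I β h D ψ' := Iff.rfl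

@[simp] theorem satOn_not (ψ : MSO) : SatOn P I β h D (.not ψ) ↔ ¬ SatOn P I β h D ψ := Iff.rfl

@[simp] theorem satOn_exPos (F : ℕ → MSO) : SatOn P I β h D (.exPos F) ↔
    ∃ i, (1 ≤ i ∧ i ≤ h.length) ∧ i ∈ D ∧ SatOn P I β h D (F i) := Iff.rfl

@[simp] theorem satOn_exSet (F : Set ℕ → MSO) : SatOn P I β h D (.exSet F) ↔
    ∃ X : Set ℕ, (∀ i ∈ X, (1 ≤ i ∧ i ≤ h.length) ∧ i ∈ D) ∧ SatOn P I β h D (F X) := Iff.rfl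

@[simp] theorem satOn_ex (S : MSort) (F : S.Carrier → MSO) :
    SatOn P I β h D (.ex S F) ↔ ∃ a, SatOn P I β h D (F a) := Iff.rfl

@[simp] theorem satOn_evAt (i : ℕ) (e : Event Value) :
    SatOn P I β h D (.evAt i e) ↔ elemAt h i = some (.ev e) := Iff.rfl

@[simp] theorem satOn_isEvent (i : ℕ) : SatOn P I β h D (.isEvent i) ↔
    (∃ e, elemAt h i = some (.ev e)) ∨ elemAt h i = some .mark := Iff.rfl

@[simp] theorem satOn_isState (i : ℕ) :
    SatOn P I β h D (.isState i) ↔ ∃ s, elemAt h i = some (.st s) := Iff.rfl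

@[simp] theorem satOn_stAt (i : ℕ) (φ : FOS) : SatOn P I β h D (.stAt i φ) ↔
    ∃ s, elemAt h i = some (.st s) ∧ φ.Sat P I β s := Iff.rfl

theorem satOn_disj {l : List MSO} : SatOn P I β h D (disj l) ↔ ∃ ψ ∈ l, SatOn P I β h D ψ := by
  induction l with
  | nil => simp [disj, fls]
  | cons ψ l ih => simp [disj, ih]

/-- Syntactic relativization is restriction of the domain of positions, also when it is nested. -/
@[simp] theorem satOn_rel (g : ℕ → MSO) (ψ : MSO) : SatOn P I β h D (rel g ψ) ↔
    SatOn P I β h (D ∩ {i | SatOn P I β h D (g i)}) ψ := by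
  induction ψ with
  | or ψ ψ' ih ih' => simp only [rel, SatOn, ih, ih']
  | not ψ ih => simp only [rel, SatOn, ih]
  | exPos F ih =>
    simp only [rel, satOn_exPos, satOn_and, ih, Set.mem_inter_iff, Set.mem_ofPred_eq, and_assoc]
  | exSet F ih =>
    simp only [rel, satOn_exSet, satOn_and, ih, Set.mem_inter_iff, Set.mem_ofPred_eq, satOn_allPos,
      satOn_imp, satOn_mem]
    refine exists_congr fun X => ⟨fun ⟨h₁, h₂, h₃⟩ => ⟨fun i hi => ⟨(h₁ i hi).1, (h₁ i hi).2,
      h₂ i (h₁ i hi).1 (h₁ i hi).2 hi⟩, h₃⟩, fun ⟨h₁, h₃⟩ => ⟨fun i hi => ⟨(h₁ i hi).1,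
      (h₁ i hi).2.1⟩, fun i _ _ hi => (h₁ i hi).2.2, h₃⟩⟩
  | ex S F ih => simp only [rel, satOn_ex, ih]
  | _ => rfl

end MSO

/-! ### Calls in models of method types -/

open MSO

/-- A set of positions that contains one before and one after `i`, but not `i`, has consecutive
elements around `i`. -/
theorem exists_consecutive {J : Set ℕ} {a b i : ℕ} (ha : a ∈ J) (hb : b ∈ J) (hai : a ≤ i)
    (hib : i ≤ b) (hi : i ∉ J) :
    ∃ j ∈ J, ∃ k ∈ J, j < i ∧ i < k ∧ ∀ l ∈ J, l ≤ j ∨ k ≤ l := by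
  classical
  have hk : ∃ k, k ∈ J ∧ i ≤ k := ⟨b, hb, hib⟩
  have hj : ∃ j, j ∈ J ∧ j ≤ i := ⟨a, ha, hai⟩
  have hj₁ := Nat.findGreatest_spec (P := fun j => j ∈ J ∧ j ≤ i) hai ⟨ha, hai⟩
  refine ⟨_, hj₁.1, Nat.find hk, (Nat.find_spec hk).1, lt_of_le_of_ne hj₁.2 ?_,
    lt_of_le_of_ne (Nat.find_spec hk).2 ?_, fun l hl => ?_⟩
  · intro he
    exact hi (he ▸ hj₁.1)
  · intro he
    exact hi (he ▸ (Nat.find_spec hk).1)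
  · rcases le_total l i with hli | hil
    · exact .inl (Nat.le_findGreatest hli ⟨hl, hli⟩)
    · exact .inr (Nat.find_min' hk ⟨hl, hil⟩)

/-- In a model of a method type, every invocation event is described by some call action of the
type, whose condition holds in the state before the event. -/
theorem MType.calls_of_satOn {P : Program} {I : Interp} {β : ℕ → LVal} {h : Hist Value}
    {ω : ℕ → ℕ} {i : ℕ} {X X' f : Value} {m : MName} {es : List Value}
    (hi : 1 ≤ i ∧ i ≤ h.length) (hev : elemAt h i = some (.ev (.invEv X X' f m es)))
    (L : MType) {D : Set ℕ} (hiD : i ∈ D) (hL : SatOn P I β h D (L.transl P ω)) :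
    ∃ φ, L.Calls m φ ∧ ∃ s, elemAt h (i - 1) = some (.st s) ∧
      (φ.subst fun v => ((P.paramNames m).zip es).lookup v).Sat P I β s := by
  induction L generalizing D with
  | call Y n φ =>
    obtain ⟨x, g, es', hL⟩ := hL
    simp only [satOn_exPos, satOn_and, satOn_evAt, satOn_stAt, onlyEventAt,
      satOn_allPos, satOn_imp, satOn_isEvent, satOn_not, satOn_eqPos] at hL
    obtain ⟨j, _, _, ⟨hj, hs⟩, ho⟩ := hL
    obtain rfl : i = j := ho i hi hiD ⟨.inl ⟨_, hev⟩, by simp [hev]⟩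
    rw [hev] at hj
    cases hj
    exact ⟨φ, .call Y, hs⟩
  | ret φ =>
    obtain ⟨x, g, n, e, hL⟩ := hL
    simp only [satOn_exPos, satOn_and, satOn_evAt, satOn_stAt, onlyEventAt,
      satOn_allPos, satOn_imp, satOn_isEvent, satOn_not, satOn_eqPos] at hL
    obtain ⟨j, _, _, ⟨hj, _⟩, ho⟩ := hL
    obtain rfl : i = j := ho i hi hiD ⟨.inl ⟨_, hev⟩, by simp [hev]⟩
    simp [hev] at hj
  | skip =>
    simp only [transl, satOn_allPos, satOn_or, satOn_evAt, satOn_stAt] at hL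
    simpa [hev] using hL i hi hiD
  | seq L L' ih ih' =>
    simp only [transl, satOn_exPos, satOn_and, satOn_rel, satOn_le] at hL
    obtain ⟨j, _, _, _, h₁, h₂⟩ := hL
    rcases le_total i j with hij | hij
    · obtain ⟨φ, hc, hs⟩ := ih (D := D ∩ {l | l ≤ j}) ⟨hiD, hij⟩ h₁
      exact ⟨φ, .seqL hc, hs⟩
    · obtain ⟨φ, hc, hs⟩ := ih' (D := D ∩ {l | j ≤ l}) ⟨hiD, hij⟩ h₂
      exact ⟨φ, .seqR hc, hs⟩
  | star L ih =>
    simp only [transl, satOn_exSet, satOn_exPos, satOn_and, satOn_allPos, satOn_imp, satOn_or,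
      satOn_mem, satOn_isState, satOn_isEvent, satOn_lt, satOn_le, satOn_evAt, satOn_rel] at hL
    obtain ⟨J, hJ, a, _, _, b, _, _, ⟨ha, hb⟩, hst, hcov, hL⟩ := hL
    have hiJ : i ∉ J := fun hiJ => by simpa [hev] using hst i hi hiD hiJ
    have hab : a ≤ i ∧ i ≤ b := by
      rcases hcov i hi hiD with ⟨_, h₁⟩ | h₁
      · simpa [hev] using h₁ (.inl ⟨_, hev⟩)
      · exact h₁
    obtain ⟨j, hj, k, hk, hji, hik, hcons⟩ := exists_consecutive ha hb hab.1 hab.2 hiJ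
    obtain ⟨φ, hc, hs⟩ := ih (D := D ∩ {l | j ≤ l ∧ l ≤ k})
      ⟨hiD, hji.le, hik.le⟩ (hL j (hJ j hj).1 (hJ j hj).2 k (hJ k hk).1
      (hJ k hk).2 ⟨⟨hj, hk⟩, hji.trans hik, fun l _ _ hl => hcons l hl⟩)
    exact ⟨φ, .star hc, hs⟩
  | oplus n Ls ih =>
    simp only [transl, satOn_disj, List.mem_ofFn] at hL
    obtain ⟨_, ⟨c, rfl⟩, hL⟩ := hL
    obtain ⟨φ, hc, hs⟩ := ih c hiD hL
    exact ⟨φ, .oplus c hc, hs⟩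
  | amp ms ψ L L' ih ih' =>
    obtain ⟨x, g, n, e, c, hL⟩ := hL
    simp only [satOn_exPos, satOn_and, satOn_allPos, satOn_imp, satOn_or,
      satOn_not, satOn_lt, satOn_le, satOn_eqPos, satOn_evAt, satOn_stAt, satOn_rel] at hL
    obtain ⟨i', _, _, j, _, _, k, _, _, _, ⟨hcov, hj, _⟩, h₁, h₂⟩ := hL
    rcases hcov i hi hiD with rfl | hki | ⟨_, hn⟩
    · simp [hev] at hj
    · by_cases hc : ∃ s, elemAt h k = some (.st s) ∧
        (ψ.subst fun v => if v = .result then some e else none).Sat P I β s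
      · obtain ⟨φ, hc, hs⟩ := ih (D := D ∩ {l | k ≤ l}) ⟨hiD, hki⟩ (h₁ hc)
        exact ⟨φ, .ampL hc, hs⟩
      · obtain ⟨φ, hc, hs⟩ := ih' (D := D ∩ {l | k ≤ l}) ⟨hiD, hki⟩ (h₂ hc)
        exact ⟨φ, .ampR hc, hs⟩
    · simp [hev] at hn

theorem exists_sat_transl_of_alphaMet {P : Program} {I : Interp} {β : ℕ → LVal} {h : Hist Value}
    {L : MType} {rs : List (ℕ × FieldName)} {ω : ℕ → ℕ}
    (H : SatOn P I β h Set.univ (alphaMet P L rs ω)) :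
    ∃ ω', SatOn P I β h Set.univ (L.transl P ω') := by
  induction rs generalizing ω with
  | nil => exact ⟨ω, H⟩
  | cons r rs ih =>
    obtain ⟨X, f⟩ := r
    obtain ⟨o, H⟩ := H
    exact ih ((satOn_and _ _).1 H).2

/-- Every invocation event in a model of the formula of a protocol is described by a call action of the
protocol. -/
theorem Protocol.calls_of_sat {P : Program} {I : Interp} {β : ℕ → LVal} {h : Hist Value}
    {p : Protocol} (H : MSO.Sat P I β h (p.formula P)) {s : State Value} {X X' f : Value}
    {m : MName} {es : List Value} (hev : [.st s, .ev (.invEv X X' f m es)] <:+: h) :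
    ∃ φ, p.type.Calls m φ ∧
      (φ.subst fun v => ((P.paramNames m).zip es).lookup v).Sat P I β s := by
  obtain ⟨ω, hω⟩ := exists_sat_transl_of_alphaMet ((MSO.satOn_univ _).2 H)
  obtain ⟨pre, post, rfl⟩ := hev
  -- Positions count from 1, so the event has the position `pre.length + 2`.
  have hs : elemAt (pre ++ [.st s, .ev (.invEv X X' f m es)] ++ post) (pre.length + 2 - 1) =
      some (.st s) := by simp [elemAt]
  have he : elemAt (pre ++ [.st s, .ev (.invEv X X' f m es)] ++ post) (pre.length + 2) =
      some (.ev (.invEv X X' f m es)) := by simp [elemAt]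
  obtain ⟨φ, hc, s', hs', hφ⟩ := MType.calls_of_satOn (i := pre.length + 2)
    ⟨by omega, by simp⟩ he p.type (Set.mem_univ _) hω
  rw [hs] at hs'
  cases hs'
  exact ⟨φ, hc, hφ⟩

/-! ### State formulas -/

/-- The local state is overridden by a partial assignment of values to variables. -/
def State.override (s : State Value) (r : VarName → Option Value) : State Value :=
  ⟨fun v => (r v).getD (s.loc v), s.heap⟩

/-- Replacing program variables by values amounts to overriding the local state. -/
theorem FTerm.eval_subst (I : Interp) (β : ℕ → LVal) (s : State Value)
    (r : VarName → Option Value) (t : FTerm) :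
    (t.subst r).eval I β s = t.eval I β (s.override r) := by
  induction t with
  | var v => cases h : r v <;> simp [FTerm.subst, FTerm.eval, State.override, h]
  | app f n args ih => simp only [FTerm.subst, FTerm.eval, ih]
  | _ => rfl

theorem FOS.sat_subst (P : Program) (I : Interp) (β : ℕ → LVal) (s : State Value)
    (r : VarName → Option Value) (φ : FOS) :
    (φ.subst r).Sat P I β s ↔ φ.Sat P I β (s.override r) := by
  induction φ generalizing β with
  | pred p n args => simp only [FOS.subst, FOS.Sat, FTerm.eval_subst]
  | eq t t' => simp only [FOS.subst, FOS.Sat, FTerm.eval_subst]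
  | or φ φ' ih ih' => simp only [FOS.subst, FOS.Sat, ih, ih']
  | not φ ih => simp only [FOS.subst, FOS.Sat, ih]
  | ex x S φ ih => simp only [FOS.subst, FOS.Sat, ih]

theorem FTerm.eval_congr {I : Interp} {V : Set VarName} {s s' : State Value}
    (hs : ∀ v ∈ V, s.loc v = s'.loc v) (β : ℕ → LVal) {t : FTerm} (ht : t.OnlyVars V) :
    t.eval I β s = t.eval I β s' := by
  induction t with
  | var v => simp only [FTerm.eval, hs v ht]
  | heap => exact ht.elim
  | app f n args ih => simp only [FTerm.eval, fun i => ih i (ht i)]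
  | _ => rfl

theorem FOS.sat_congr {P : Program} {I : Interp} {V : Set VarName} {s s' : State Value}
    (hs : ∀ v ∈ V, s.loc v = s'.loc v) (β : ℕ → LVal) {φ : FOS} (hφ : φ.OnlyVars V) :
    φ.Sat P I β s ↔ φ.Sat P I β s' := by
  induction φ generalizing β with
  | pred p n args =>
    have h : (fun i => (args i).eval I β s) = fun i => (args i).eval I β s' :=
      funext fun i => FTerm.eval_congr hs β (hφ i)
    simp only [FOS.Sat, h]
  | eq t t' => simp only [FOS.Sat, FTerm.eval_congr hs β hφ.1, FTerm.eval_congr hs β hφ.2]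
  | or φ φ' ih ih' => simp only [FOS.Sat, ih β hφ.1, ih' β hφ.2]
  | not φ ih => simp only [FOS.Sat, ih β hφ]
  | ex x S φ ih => simp only [FOS.Sat, fun a => ih (Function.update β x a) hφ]

theorem exists_lookup_zip {l : List VarName} {as : List Value} (hl : as.length = l.length)
    {v : VarName} (hv : v ∈ l) : ∃ a, (l.zip as).lookup v = some a := by
  induction l generalizing as with
  | nil => simp at hv
  | cons w l ih =>
    obtain _ | ⟨a, as⟩ := as
    · simp at hl
    · by_cases hw : v = w
      · exact ⟨a, by simp [hw]⟩
      · obtain ⟨b, hb⟩ := ih (by simpa using hl) ((List.mem_cons.1 hv).resolve_left hw)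
        exact ⟨b, by simp [List.lookup_cons, beq_false_of_ne hw, hb]⟩

/-- A predicate on the parameters of `m` that holds when the parameters are replaced by the
arguments of a call also holds in the initial local state of the called method. -/
theorem FOS.sat_initLoc {P : Program} {I : Interp} {β : ℕ → LVal} {φ : FOS} {m : MName}
    {es : List Value} {s s' : State Value} (hφ : φ.OnlyVars {v | v ∈ P.paramNames m})
    (hes : es.length = (P.paramNames m).length)
    (hs' : ∀ v, s'.loc v = P.initLoc m es v)
    (h : φ.Sat P I β (s.override fun v => ((P.paramNames m).zip es).lookup v)) :
    φ.Sat P I β s' := by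
  refine (FOS.sat_congr (fun v hv => ?_) β hφ).1 h
  obtain ⟨a, ha⟩ := exists_lookup_zip hes hv
  simp [hs', State.override, Program.initLoc, ha]

/-! ### Selected traces are concrete -/

theorem Trace.valSubst_eq_some {δ : Sym → Value} {θ : Trace} {x : Sym} {v : Value} :
    θ.valSubst δ x = some v ↔ x ∈ θ.introduced ∧ δ x = v := by
  simp [Trace.valSubst]

theorem Concretizer.Records.extends_valSubst {χ : Concretizer} {A : Agreement} {θ : Trace}
    (h : χ.Records A θ) : χ.Extends ((θ.applyHeap A.heap).valSubst A.δ) := fun x _ hv => by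
  obtain ⟨hx, rfl⟩ := Trace.valSubst_eq_some.1 hv
  exact h.2 x hx

theorem Concretizer.Records.subst_eq {χ : Concretizer} {A : Agreement} {θ : Trace}
    (h : χ.Records A θ) :
    ((θ.applyHeap A.heap).subst ((θ.applyHeap A.heap).valSubst A.δ)).hs.subst χ.toSubst =
      θ.hs.subst χ.toSubst :=
  (Hist.subst_subst h.extends_valSubst _).trans (Hist.subst_subst h.1 _)

theorem Trace.Selected.exists_remainder {ρ : FieldName → Value} {δ : Sym → Value} {θ : Trace}
    (h : θ.Selected ρ δ) : ∃ θ', θ.Remainder ρ δ θ' := by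
  obtain ⟨θC, ⟨s, e, s', r, hs, -⟩, -⟩ := h
  exact ⟨_, _, _, _, by simp only [Trace.subst, hs, Hist.subst, List.map_cons, Elem.map]; rfl, rfl⟩

/-- A selected trace of an agreeing process starts with the agreed step. -/
theorem Agreement.Valid.prefix_subst {A : Agreement} (hA : A.Valid) {θ : Trace} (hθ : θ ∈ A.proc)
    (hs : θ.Selected A.heap A.δ) {χ : Concretizer} (hχ : χ.Records A θ) :
    Hist.embed A.hist <+: θ.hs.subst χ.toSubst := by
  obtain ⟨θC, hC, hsel⟩ := hs
  have heq := hA.2.2.1 θ hθ θC hC hsel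
  obtain ⟨s, e, s', r, hθs, hCs, -⟩ := hC
  have hin : θC.introduced = (θ.applyHeap A.heap).introduced := by
    simp only [Trace.introduced, hCs, hθs]
  have hext : χ.Extends (θC.valSubst A.δ) := fun x v hv => by
    obtain ⟨hx, rfl⟩ := Trace.valSubst_eq_some.1 hv
    exact hχ.2 x (hin ▸ hx)
  have h₁ : (θ.applyHeap A.heap).hs = θC.hs ++ r := by rw [hθs, hCs]; rfl
  have h₂ : θC.hs.subst χ.toSubst = Hist.embed A.hist := by
    rw [← Hist.subst_subst hext, show θC.hs.subst (θC.valSubst A.δ) = _ from heq,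
      Hist.subst_embed]
  have h₃ : θ.hs.subst χ.toSubst = (θ.applyHeap A.heap).hs.subst χ.toSubst :=
    (Hist.subst_subst hχ.1 _).symm
  rw [h₃, h₁, ← h₂]
  exact ⟨Hist.subst χ.toSubst r, by simp [Hist.subst]⟩

theorem Trace.Remainder.suffix_subst {A : Agreement} {θ θ' : Trace}
    (h : θ.Remainder A.heap A.δ θ') {χ : Concretizer} (hχ : χ.Records A θ) :
    θ'.hs.subst χ.toSubst <:+ θ.hs.subst χ.toSubst := by
  obtain ⟨s, e, r, hs, rfl⟩ := h
  rw [← hχ.subst_eq, hs]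
  exact List.IsSuffix.map _ ((Hist.dropMark_suffix r).trans ⟨[_, _], rfl⟩)

theorem Trace.Remainder.alternates {ρ : FieldName → Value} {δ : Sym → Value} {θ θ' : Trace}
    (h : θ.Remainder ρ δ θ') (hθ : θ.hs.Alternates) : θ'.hs.Alternates := by
  obtain ⟨s, e, r, hs, rfl⟩ := h
  have := (hθ.map (SymExpr.subst (θ.heapSubst ρ))).map
    (SymExpr.subst ((θ.applyHeap ρ).valSubst δ))
  exact (hs ▸ this : Hist.Alternates (.st s :: .ev e :: r)).rest.1

/-- If the remainder of a selected trace becomes concrete, or is a single state, then the trace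
itself becomes concrete. -/
theorem Trace.Remainder.concretizes {A : Agreement} (hA : A.Valid) {θ θ' : Trace}
    (h : θ.Remainder A.heap A.δ θ') (hθ : θ.hs.Alternates) (hp : θ ∈ A.proc)
    (hs : θ.Selected A.heap A.δ) {χ : Concretizer} (hχ : χ.Records A θ)
    (h' : θ'.hs.length = 1 ∨ ∃ l, Concretizes χ θ' l) : ∃ l, Concretizes χ θ l := by
  have hpre := hA.prefix_subst hp hs hχ
  obtain ⟨s, e, r, hr, rfl⟩ := h
  have halt := (hθ.map (SymExpr.subst (θ.heapSubst A.heap))).map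
    (SymExpr.subst ((θ.applyHeap A.heap).valSubst A.δ))
  have hrest := (hr ▸ halt : Hist.Alternates (.st s :: .ev e :: r)).rest.2
  unfold Concretizes
  rw [← hχ.subst_eq, hr] at hpre ⊢
  obtain ⟨t, ht⟩ := hpre
  simp only [Hist.embed, Agreement.hist, List.map_cons, List.map_nil, Hist.subst, List.cons_append,
    List.nil_append, List.cons.injEq] at ht
  obtain ⟨h₁, h₂, h₃⟩ := ht
  obtain ⟨s', ⟨r', rfl, hd⟩ | ⟨hd, hlen⟩⟩ := hrest
  · rw [hd] at h'
    rcases h' with h' | ⟨l, hl⟩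
    · have : r' = [] := by simpa using h'
      subst this
      refine ⟨A.hist, ?_⟩
      simp only [Hist.subst, Hist.embed, Agreement.hist, List.map_cons, List.map_nil,
        List.cons.injEq] at h₃ ⊢
      exact ⟨h₁.symm, h₂.symm, h₃.1.symm, trivial⟩
    · refine ⟨.st A.pre :: .ev A.ev :: l, ?_⟩
      simp only [Concretizes] at hl
      simp only [Hist.subst, Hist.embed, List.map_cons] at hl ⊢
      rw [← h₁, ← h₂, ← hl]
  · rcases h' with h' | ⟨l, hl⟩
    · exact absurd h' hlen.ne'
    · refine ⟨.st A.pre :: .ev A.ev :: .st A.post :: .mark :: l, ?_⟩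
      simp only [Concretizes] at hl
      rw [hd] at h₃ ⊢
      simp only [Hist.subst, Hist.embed, List.map_cons, List.cons.injEq] at hl h₃ ⊢
      exact ⟨h₁.symm, h₂.symm, h₃.1.symm, rfl, hl⟩

theorem Follows.concretizes {As : List Agreement} (hAs : ∀ A ∈ As, A.Valid) {χ : Concretizer}
    {θ : Trace} (h : Follows As χ θ) (hθ : θ.hs.Alternates) : ∃ l, Concretizes χ θ l := by
  induction h with
  | last hA hp hs hχ hr hl => exact hr.concretizes (hAs _ hA) hθ hp hs hχ (.inl hl)
  | step hA hp hs hχ hr _ _ ih =>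
    exact hr.concretizes (hAs _ hA) hθ hp hs hχ (.inr (ih (hr.alternates hθ)))

/-! ### Following a trace -/

theorem Trace.Remainder.syms {A : Agreement} {θ θ' : Trace} (h : θ.Remainder A.heap A.δ θ')
    {x : Sym} (hx : x ∈ θ'.hs.syms) : x ∈ θ.hs.syms ∧ θ.heapSubst A.heap x = none ∧
      (θ.applyHeap A.heap).valSubst A.δ x = none := by
  obtain ⟨s, e, r, hs, rfl⟩ := h
  have h₁ : x ∈ ((θ.applyHeap A.heap).subst ((θ.applyHeap A.heap).valSubst A.δ)).hs.syms := by
    rw [hs]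
    exact Hist.syms_mono (((Hist.dropMark_suffix r).trans ⟨[_, _], rfl⟩).subset) hx
  have h₂ := Hist.syms_subst h₁
  have h₃ := Hist.syms_subst h₂.1
  exact ⟨h₃.1, h₃.2, h₂.2⟩

/-- Only the placeholders of the followed trace matter for the concretizer. -/
theorem Follows.congr {As : List Agreement} {χ χ' : Concretizer} {θ : Trace}
    (h : Follows As χ θ) (hχ : ∀ x ∈ θ.hs.syms, χ' x = χ x) : Follows As χ' θ := by
  have hrec {A : Agreement} {θ : Trace} (hχ : ∀ x ∈ θ.hs.syms, χ' x = χ x)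
      (hr : χ.Records A θ) : χ'.Records A θ :=
    ⟨fun x v hv => (hχ x (Trace.heapSubst_mem hv)).trans (hr.1 x v hv),
      fun x hx => (hχ x (Hist.syms_subst (Trace.introduced_subset _ hx)).1).trans (hr.2 x hx)⟩
  induction h with
  | last hA hp hs hr hm hl => exact .last hA hp hs (hrec hχ hr) hm hl
  | step hA hp hs hr hm hl _ ih =>
    exact .step hA hp hs (hrec hχ hr) hm hl (ih fun x hx => hχ x (hm.syms hx).1)

/-- A concretizer can be changed to record the substitutions of an agreement, since those
eliminate the placeholders that they replace from the remainder. -/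
theorem Concretizer.exists_records (χ : Concretizer) (A : Agreement) (θ : Trace) :
    ∃ χ' : Concretizer, χ'.Records A θ ∧
      ∀ θ', θ.Remainder A.heap A.δ θ' → ∀ x ∈ θ'.hs.syms, χ' x = χ x := by
  refine ⟨fun x => (θ.heapSubst A.heap x).getD
    (((θ.applyHeap A.heap).valSubst A.δ x).getD (χ x)), ⟨fun x v hv => ?_, fun x hx => ?_⟩,
    fun θ' hm x hx => ?_⟩
  · simp [hv]
  · have hn := (Hist.syms_subst (Trace.introduced_subset _ hx)).2
    simp [hn, Trace.valSubst_eq_some.2 ⟨hx, rfl⟩]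
  · obtain ⟨-, h₁, h₂⟩ := hm.syms hx
    simp [h₁, h₂]

/-- If the continuation of an agreement is empty or has a trace that can be followed to its end,
then so has the agreeing process, by a trace that starts with the agreed step. -/
theorem Agreement.exists_follows {As : List Agreement} {A : Agreement} (hA : A ∈ As)
    (hv : A.Valid) (halt : ∀ θ ∈ A.proc, θ.hs.Alternates)
    (hc : A.cont.Nonempty → ∃ θ ∈ A.cont, ∃ χ, Follows As χ θ) :
    ∃ θ ∈ A.proc, ∃ χ, Follows As χ θ ∧ Hist.embed A.hist <+: θ.hs.subst χ.toSubst := by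
  by_cases hne : A.cont.Nonempty
  · obtain ⟨θ', hθ', χ', hf⟩ := hc hne
    rw [hv.2.2.2] at hθ'
    obtain ⟨hl, θ, hp, hs, hr⟩ := hθ'
    obtain ⟨χ, hχ, hag⟩ := χ'.exists_records A θ
    exact ⟨θ, hp, χ, .step hA hp hs hχ hr hl (hf.congr (hag _ hr)), hv.prefix_subst hp hs hχ⟩
  · obtain ⟨θ, hp, hs⟩ := hv.2.1
    obtain ⟨θ', hr⟩ := hs.exists_remainder
    obtain ⟨χ, hχ, -⟩ := Concretizer.exists_records (fun _ => .unit) A θ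
    have hl : ¬ 1 < θ'.hs.length := fun hl => hne ⟨θ', by
      rw [hv.2.2.2]
      exact ⟨hl, θ, hp, hs, hr⟩⟩
    have hl' : θ'.hs.length ≠ 0 := by
      have := hr.alternates (halt θ hp)
      generalize θ'.hs = l at this
      cases this <;> simp
    exact ⟨θ, hp, χ, .last hA hp hs hχ hr (by omega), hv.prefix_subst hp hs hχ⟩

/-- `Descends As Θ p`: the process `p` results from `Θ` by successive agreements from `As`. -/
inductive Descends (As : List Agreement) (Θ : Set Trace) : Set Trace → Prop
  | refl : Descends As Θ Θ
  | step {A} : A ∈ As → A.Valid → Descends As Θ A.proc → Descends As Θ A.cont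

theorem Descends.alternates {As : List Agreement} {Θ p : Set Trace} (h : Descends As Θ p)
    (hΘ : ∀ θ ∈ Θ, θ.hs.Alternates) : ∀ θ ∈ p, θ.hs.Alternates := by
  induction h with
  | refl => exact hΘ
  | step _ hv _ ih =>
    intro θ hθ
    rw [hv.2.2.2] at hθ
    obtain ⟨-, θ₁, hp, -, hr⟩ := hθ
    exact hr.alternates (ih θ₁ hp)

/-- A followed trace of a process continues a followed trace of the process from which it
descends. -/
theorem Descends.exists_follows {As : List Agreement} {Θ p : Set Trace} (h : Descends As Θ p)
    {θ : Trace} (hθ : θ ∈ p) {χ : Concretizer} (hf : Follows As χ θ) :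
    ∃ θ₀ ∈ Θ, ∃ χ₀ : Concretizer, Follows As χ₀ θ₀ ∧
      θ.hs.subst χ.toSubst <:+ θ₀.hs.subst χ₀.toSubst := by
  induction h generalizing θ χ with
  | refl => exact ⟨θ, hθ, χ, hf, List.suffix_refl _⟩
  | step hA hv _ ih =>
    rw [hv.2.2.2] at hθ
    obtain ⟨hl, θ₁, hp, hs, hr⟩ := hθ
    obtain ⟨χ₁, hχ, hag⟩ := χ.exists_records _ θ₁
    obtain ⟨θ₀, h₀, χ₀, hf₀, hsuf⟩ := ih hp (.step hA hp hs hχ hr hl (hf.congr (hag _ hr)))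
    refine ⟨θ₀, h₀, χ₀, hf₀, List.IsSuffix.trans ?_ hsuf⟩
    rw [← Hist.subst_congr (δ := χ₁.toSubst) (δ' := χ.toSubst) fun x hx => congrArg some (hag _ hr x hx)]
    exact hr.suffix_subst hχ

/-! ### Runs -/

/-- The process `p` is in the pool of the object or active. An empty set in the place of the active
process means that no process is active. -/
def Obj.HasProc (O : Obj) (p : Set Trace) : Prop := p ∈ O.pool ∨ (p = O.active ∧ p.Nonempty)

/-- Some object of the system has the process `p`. -/
def Sys.HasProc {P : Program} (S : Sys P) (p : Set Trace) : Prop := ∃ i, (S.objs i).HasProc p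

theorem ObjStep.valid {O O' : Obj} {A : Agreement} (h : ObjStep O A O') : A.Valid := by
  cases h <;> assumption

theorem ObjStep.hasProc_proc {O O' : Obj} {A : Agreement} (h : ObjStep O A O') :
    O.HasProc A.proc := by
  obtain ⟨θ, hθ, -⟩ := h.valid.2.1
  cases h with
  | schedule => exact .inl (Multiset.mem_cons_self _ _)
  | _ => exact .inr ⟨rfl, θ, hθ⟩

theorem ObjStep.hasProc_cont {O O' : Obj} {A : Agreement} (h : ObjStep O A O')
    (hne : A.cont.Nonempty) : O'.HasProc A.cont := by
  cases h with
  | deschedule => exact .inl (Multiset.mem_cons_self _ _)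
  | _ => exact .inr ⟨rfl, hne⟩

theorem ObjStep.hasProc_of_after {O O' : Obj} {A : Agreement} (h : ObjStep O A O') {p : Set Trace}
    (hp : O'.HasProc p) : O.HasProc p ∨ p = A.cont := by
  cases h with
  | schedule =>
    rcases hp with hp | ⟨rfl, -⟩
    · exact .inl (.inl (Multiset.mem_cons_of_mem hp))
    · exact .inr rfl
  | step =>
    rcases hp with hp | ⟨rfl, -⟩
    · exact .inl (.inl hp)
    · exact .inr rfl
  | deschedule =>
    rcases hp with hp | ⟨rfl, hn⟩
    · rcases Multiset.mem_cons.1 hp with rfl | hp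
      · exact .inr rfl
      · exact .inl (.inl hp)
    · exact absurd hn Set.not_nonempty_empty

theorem ObjStep.hasProc_of_before {O O' : Obj} {A : Agreement} (h : ObjStep O A O')
    {p : Set Trace} (hp : O.HasProc p) : O'.HasProc p ∨ p = A.proc := by
  cases h with
  | schedule =>
    rcases hp with hp | ⟨rfl, hn⟩
    · rcases Multiset.mem_cons.1 hp with rfl | hp
      · exact .inr rfl
      · exact .inl (.inl hp)
    · exact absurd hn Set.not_nonempty_empty
  | step =>
    rcases hp with hp | ⟨rfl, -⟩
    · exact .inl (.inl hp)
    · exact .inr rfl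
  | deschedule =>
    rcases hp with hp | ⟨rfl, -⟩
    · exact .inl (.inl (Multiset.mem_cons_of_mem hp))
    · exact .inr rfl

/-- `Θ` is the semantics of the method `m` for the arguments `es`, obtained by a substitution in the
fully symbolic start. -/
def Program.StartedWith (P : Program) (m : MName) (es : List Value) (Θ : Set Trace) : Prop :=
  ∃ (D : ClassDecl) (M : MethDecl) (δ : Subst), P.lookup m = some (D, M) ∧
    es.length = (P.paramNames m).length ∧ δ.KeepsFresh ∧
    (∀ v, δ (.loc v) = some (P.initLoc m es v)) ∧
    Θ = P.methSem m ((SymExpr.sym .self).subst δ) ((SymExpr.sym .fut).subst δ)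
      ((symState D.parNames).map (SymExpr.subst δ))

/-- The substitution of the placeholders of a fully symbolic start by an object, a future, a local
state, the class parameters and the entries of the initial heap. -/
def startSubst (X n : ℕ) (loc : VarName → Value) (par : FieldName → Value)
    (fld : FieldName → Option Value) : Subst
  | .self => some (.obj X)
  | .fut => some (.fut (some n))
  | .loc v => some (loc v)
  | .cparam p => some (par p)
  | .field f 0 => fld f
  | _ => none

theorem startSubst_keepsFresh (X n : ℕ) (loc : VarName → Value) (par : FieldName → Value)
    (fld : FieldName → Option Value) : (startSubst X n loc par fld).KeepsFresh :=
  ⟨fun _ => rfl, fun _ => rfl, fun _ k hk => by cases k <;> [omega; rfl]⟩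

theorem Program.length_paramNames {P : Program} {m : MName} {D : ClassDecl} {M : MethDecl}
    (h : P.lookup m = some (D, M)) : (P.paramNames m).length = M.params.length := by
  simp [Program.paramNames, h]

theorem ObjAdd.startedWith {P : Program} {X n : ℕ} {C : ClassName} {m : MName} {es : List Value}
    {O O' : Obj} {Θ : Set Trace} (h : ObjAdd P X C n m es O Θ O') : P.StartedWith m es Θ := by
  obtain ⟨D, M, s, hl, -, hlen, -, rfl, -⟩ := h
  refine ⟨D, M, startSubst X n (P.initLoc m es) s.heap (fun _ => none), hl,
    hlen.trans (P.length_paramNames hl).symm, startSubst_keepsFresh .., fun _ => rfl, ?_⟩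
  congr 1
  simp only [symState, State.map, State.mk.injEq]
  refine ⟨rfl, funext fun f => ?_⟩
  by_cases hf : f ∈ D.parNames <;> simp [idHeap, hf, SymExpr.subst, startSubst]

theorem IsInitial.startedWith {P : Program} {S : Sys P} {Θ : Set Trace} (h : IsInitial P S Θ) :
    ∃ es, P.StartedWith P.callMeth es Θ := by
  obtain ⟨j, n, es, D, M, -, hl, -, hlen, -, rfl, -⟩ := h
  refine ⟨es, D, M, startSubst j n (P.initLoc P.callMeth es) (P.initHeap (P.objects.get j))
    (fun f => some (P.initHeap (P.objects.get j) f)), hl,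
    hlen.trans (P.length_paramNames hl).symm, startSubst_keepsFresh .., fun _ => rfl, ?_⟩
  congr 1
  simp only [symState, State.map, State.mk.injEq]
  refine ⟨rfl, funext fun f => ?_⟩
  by_cases hf : f ∈ D.parNames <;> simp [idHeap, hf, SymExpr.subst, startSubst]

theorem IsInitial.eq_of_hasProc {P : Program} {S : Sys P} {Θ p : Set Trace}
    (h : IsInitial P S Θ) (hp : S.HasProc p) : p = Θ := by
  obtain ⟨j, n, es, D, M, -, -, -, -, -, -, -, hj, hi⟩ := h
  obtain ⟨i, hp⟩ := hp
  by_cases hij : i = j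
  · subst hij
    rw [hj] at hp
    rcases hp with hp | ⟨rfl, hn⟩
    · exact Multiset.mem_singleton.1 hp
    · exact absurd hn Set.not_nonempty_empty
  · rw [hi i hij] at hp
    rcases hp with hp | ⟨rfl, hn⟩
    · exact absurd hp (Multiset.notMem_zero _)
    · exact absurd hn Set.not_nonempty_empty

theorem Sys.hasProc_update {P : Program} {S : Sys P} {evs : List (Event Value)}
    {i : Fin P.objects.length} {O' : Obj} {p : Set Trace}
    (h : Sys.HasProc ⟨evs, Function.update S.objs i O'⟩ p) : S.HasProc p ∨ O'.HasProc p := by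
  obtain ⟨k, hk⟩ := h
  by_cases hki : k = i
  · subst hki
    exact .inr (by simpa using hk)
  · exact .inl ⟨k, by simpa [hki] using hk⟩

/-- The facts about processes that hold for each step of a system. -/
structure StepFacts {P : Program} (S : Sys P) (l : StepLabel) (S' : Sys P) : Prop where
  valid : l.agr.Valid
  proc : S.HasProc l.agr.proc
  cont : l.agr.cont.Nonempty → S'.HasProc l.agr.cont
  before : ∀ p, S.HasProc p → S'.HasProc p ∨ p = l.agr.proc
  after : ∀ p, S'.HasProc p → S.HasProc p ∨ p = l.agr.cont ∨ ∃ m, l.spawn = some (m, p)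
  spawn : ∀ m Θ, l.spawn = some (m, Θ) → ∃ X X' f es,
    l.agr.ev = .invEv X X' f m es ∧ P.StartedWith m es Θ

theorem ObjStep.stepFacts {P : Program} {S : Sys P} {i : Fin P.objects.length} {A : Agreement}
    {O' : Obj} (h : ObjStep (S.objs i) A O') (evs : List (Event Value)) :
    StepFacts S ⟨A, none⟩ ⟨evs, Function.update S.objs i O'⟩ where
  valid := h.valid
  proc := ⟨i, h.hasProc_proc⟩
  cont hne := ⟨i, by simpa using h.hasProc_cont hne⟩
  before := by
    rintro p ⟨k, hk⟩
    by_cases hki : k = i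
    · subst hki
      exact (h.hasProc_of_before hk).imp_left fun hp => ⟨k, by simpa using hp⟩
    · exact .inl ⟨k, by simpa [hki] using hk⟩
  after p hp := by
    rcases Sys.hasProc_update hp with hp | hp
    · exact .inl hp
    · rcases h.hasProc_of_after hp with hp | hp
      · exact .inl ⟨i, hp⟩
      · exact .inr (.inl hp)
  spawn _ _ hs := by simp at hs

theorem SysStep.stepFacts {P : Program} {S S' : Sys P} {l : StepLabel} (h : SysStep P S l S') :
    StepFacts S l S' := by
  cases h with
  | internal ho => exact ho.stepFacts _
  | get ho => exact ho.stepFacts _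
  | @invoc i j A O' n m es Θ O'' hij ho hev hfresh hadd =>
    have hadd' := hadd
    obtain ⟨D, M, s, -, -, -, -, -, rfl⟩ := hadd'
    have hf := ho.stepFacts (S.evs ++ [A.ev])
    have hj : Function.update S.objs i O' j = S.objs j := Function.update_of_ne hij.symm _ _
    -- The callee keeps its processes when the new one is added to its pool.
    have hkeep {p : Set Trace} (hp : Sys.HasProc (P := P) ⟨S.evs ++ [A.ev],
        Function.update S.objs i O'⟩ p) : Sys.HasProc (P := P) ⟨S.evs ++ [A.ev],
        Function.update (Function.update S.objs i O') j
          ⟨Θ ::ₘ (S.objs j).pool, (S.objs j).trace, (S.objs j).active⟩⟩ p := by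
      obtain ⟨k, hk⟩ := hp
      refine ⟨k, ?_⟩
      by_cases hkj : k = j
      · subst hkj
        simp only [hj] at hk
        simp only [Function.update_self]
        exact hk.imp_left Multiset.mem_cons_of_mem
      · simpa [hkj] using hk
    refine ⟨hf.valid, hf.proc, fun hne => hkeep (hf.cont hne),
      fun p hp => (hf.before p hp).imp_left hkeep, fun p hp => ?_, fun m' Θ' hs => ?_⟩
    · rcases Sys.hasProc_update (S := ⟨S.evs ++ [A.ev], Function.update S.objs i O'⟩) hp with
        hp | hp
      · rcases hf.after p hp with hp | hp | ⟨m', hm'⟩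
        · exact .inl hp
        · exact .inr (.inl hp)
        · simp at hm'
      · rcases hp with hp | hp
        · rcases Multiset.mem_cons.1 hp with rfl | hp
          · exact .inr (.inr ⟨m, rfl⟩)
          · exact .inl ⟨j, .inl hp⟩
        · exact .inl ⟨j, .inr hp⟩
    · simp only [Option.some.injEq, Prod.mk.injEq] at hs
      obtain ⟨rfl, rfl⟩ := hs
      exact ⟨_, _, _, _, hev, hadd.startedWith⟩

theorem Run.valid {P : Program} {S S' : Sys P} {ls : List StepLabel} (h : Run P S ls S') :
    ∀ A ∈ ls.map StepLabel.agr, A.Valid := by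
  induction h with
  | nil => simp
  | cons hs _ ih =>
    intro A hA
    rcases List.mem_cons.1 hA with rfl | hA
    · exact hs.stepFacts.valid
    · exact ih A hA

theorem Program.StartedWith.alternates {P : Program} {m : MName} {es : List Value}
    {Θ : Set Trace} (h : P.StartedWith m es Θ) : ∀ θ ∈ Θ, θ.hs.Alternates := by
  obtain ⟨D, M, δ, -, -, -, -, rfl⟩ := h
  exact fun θ hθ => P.methSem_alternates hθ

theorem StepFacts.alternates {P : Program} {S S' : Sys P} {l : StepLabel} (h : StepFacts S l S')
    (halt : ∀ p, S.HasProc p → ∀ θ ∈ p, θ.hs.Alternates) :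
    ∀ p, S'.HasProc p → ∀ θ ∈ p, θ.hs.Alternates := by
  intro p hp
  rcases h.after p hp with hp | rfl | ⟨m, hm⟩
  · exact halt p hp
  · exact Descends.alternates (As := [l.agr]) (.step (by simp) h.valid .refl) (halt _ h.proc)
  · obtain ⟨_, _, _, _, -, hst⟩ := h.spawn m p hm
    exact hst.alternates

/-- In a terminating run, each non-empty process has a trace that is followed to its end. -/
theorem Run.exists_follows {P : Program} {S S' : Sys P} {ls : List StepLabel}
    (h : Run P S ls S') (hterm : S'.Terminated) {As : List Agreement}
    (hAs : ls.map StepLabel.agr ⊆ As) (halt : ∀ p, S.HasProc p → ∀ θ ∈ p, θ.hs.Alternates) :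
    ∀ p, S.HasProc p → p.Nonempty → ∃ θ ∈ p, ∃ χ, Follows As χ θ := by
  induction h with
  | nil S =>
    rintro p ⟨i, hp | ⟨rfl, -⟩⟩ hn
    · rw [(hterm i).1] at hp
      exact absurd hp (Multiset.notMem_zero _)
    · rw [(hterm i).2] at hn
      exact absurd hn Set.not_nonempty_empty
  | @cons S l S₁ ls S₂ hs _ ih =>
    have hf := hs.stepFacts
    have hlA : l.agr ∈ As := hAs (by simp)
    have halt₁ := hf.alternates halt
    have ih := ih hterm (fun A hA => hAs (List.mem_cons_of_mem _ hA)) halt₁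
    intro p hp hn
    rcases hf.before p hp with hp | rfl
    · exact ih p hp hn
    · obtain ⟨θ, hθ, χ, hχ, -⟩ := Agreement.exists_follows hlA hf.valid (halt _ hp)
        fun hne => ih _ (hf.cont hne) hne
      exact ⟨θ, hθ, χ, hχ⟩

/-- In a terminating run that starts with the step `l`, the step belongs to a trace of its process
that is followed to its end. -/
theorem Run.exists_follows_cons {P : Program} {S S₁ S' : Sys P} {l : StepLabel}
    {ls : List StepLabel} (hs : SysStep P S l S₁) (h : Run P S₁ ls S') (hterm : S'.Terminated)
    {As : List Agreement} (hl : l.agr ∈ As) (hAs : ls.map StepLabel.agr ⊆ As)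
    (halt : ∀ p, S.HasProc p → ∀ θ ∈ p, θ.hs.Alternates) :
    ∃ θ ∈ l.agr.proc, ∃ χ, Follows As χ θ ∧
      Hist.embed l.agr.hist <+: θ.hs.subst χ.toSubst :=
  Agreement.exists_follows hl hs.stepFacts.valid (halt _ hs.stepFacts.proc)
    fun hne => h.exists_follows hterm hAs (hs.stepFacts.alternates halt) _ (hs.stepFacts.cont hne) hne

/-! ### Preconditions at calls -/

theorem Event.map_id {E : Type} (e : Event E) : e.map id = e := by
  cases e <;> simp [Event.map]

theorem Elem.map_id {E : Type} (a : Elem E) : a.map id = a := by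
  cases a with
  | ev e => exact congrArg Elem.ev e.map_id
  | _ => rfl

theorem Hist.infix_of_embed {h h' : Hist Value} (hi : h.embed <:+: h'.embed) : h <:+: h' := by
  let g : SymExpr → Value := fun e => match e with
    | .val v => v
    | _ => .unit
  have hg (l : Hist Value) : List.map (Elem.map g) l.embed = l := by
    rw [Hist.embed, List.map_map]
    exact (List.map_congr_left fun a _ => (Elem.map_map g SymExpr.val a).trans a.map_id).trans
      (List.map_id l)
  rw [← hg h, ← hg h']
  exact hi.map _

/-- A followed trace of a started process is an instance of a selected, fully symbolic trace. -/
theorem Program.StartedWith.exists_selected {P : Program} {m : MName} {es : List Value}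
    {Θ Θ₀ : Set Trace} {S S' : Sys P} {ls : List StepLabel} (hst : P.StartedWith m es Θ)
    (hinit : IsInitial P S Θ₀) (hrun : Run P S ls S') (hterm : S'.Terminated)
    (hΘ : (m, Θ) ∈ (P.callMeth, Θ₀) :: ls.filterMap StepLabel.spawn) {θ₀ : Trace} (hθ₀ : θ₀ ∈ Θ)
    {χ₀ : Concretizer} (hf : Follows (ls.map StepLabel.agr) χ₀ θ₀) :
    ∃ (θ : Trace) (χ : Concretizer) (δ : Subst), SelectedTrace P m θ χ ∧ χ.Extends δ ∧
      θ.subst δ = θ₀ ∧ θ.hs.subst χ.toSubst = θ₀.hs.subst χ₀.toSubst := by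
  have hst' := hst
  obtain ⟨D, M, δ, hl, -, hδ, -, rfl⟩ := hst'
  obtain ⟨θ, hθ, rfl⟩ := Program.methSem_lift hδ hθ₀
  let χ : Concretizer := fun x => (δ x).getD (χ₀ x)
  have hext : χ.Extends δ := fun x v hv => by simp [χ, hv]
  have hag : ∀ x ∈ (θ.subst δ).hs.syms, χ x = χ₀ x := fun x hx => by
    simp [χ, (Hist.syms_subst hx).2]
  refine ⟨θ, χ, δ, ⟨⟨D, M, hl, hθ⟩, S, Θ₀, ls, S', hinit, hrun, hterm, _, hΘ, _, hθ₀, δ, hext, rfl,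
    hf.congr hag⟩, hext, rfl, ?_⟩
  rw [← Hist.subst_subst hext]
  exact Hist.subst_congr fun x hx => congrArg some (hag x hx)

/-- The precondition of `m` holds in the initial local state of the process `Θ`, and thus in the
first state of each trace of `m` that is selected from this process. -/
def MeetsPre (P : Program) (I : Interp) (T : MName → Protocol) (m : MName) (Θ : Set Trace) :
    Prop :=
  ∃ es, P.StartedWith m es Θ ∧
    ∀ β s, (∀ v, s.loc v = P.initLoc m es v) → (T m).pre.Sat P I β s

/-- If a selected trace belongs to a process that is started in a state with the precondition of its
method, then the validity of the proof obligation applies to it. -/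
theorem MeetsPre.sat_formula {P : Program} {I : Interp} {T : MName → Protocol}
    (hvalid : ∀ m C M, P.lookup m = some (C, M) →
      ObligationValid P I m (T m).pre M.body ((T m).formula P))
    {m : MName} {Θ : Set Trace} (hΘ : MeetsPre P I T m Θ) {θ : Trace} {χ : Concretizer}
    (hsel : SelectedTrace P m θ χ) {δ : Subst} (hδ : χ.Extends δ) (hθ : θ.subst δ ∈ Θ)
    {h : Hist Value} (hh : Concretizes χ θ h) :
    ∃ s X f as h', h = .st s :: .ev (.invREv X f m as) :: h' ∧
      ∀ β, MSO.Sat P I β h' ((T m).formula P) := by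
  obtain ⟨es, ⟨D, M, δ₀, -, -, -, hloc, rfl⟩, hpre⟩ := hΘ
  obtain ⟨-, -, τ', -, -, hτ'⟩ := hθ
  obtain ⟨⟨C, M, hl, C', M', τ, hl', hτ, rfl⟩, -⟩ := id hsel
  obtain ⟨rfl, rfl⟩ : C = C' ∧ M = M' := by simpa using hl.symm.trans hl'
  obtain ⟨r, hr⟩ := hτ.head
  -- The first state of the started process shows the values of the variables under `χ`.
  have hχ (v : VarName) : χ (.loc v) = P.initLoc m es v := by
    have h₁ : ((SymExpr.sym (.loc v)).subst δ) = (SymExpr.sym (.loc v)).subst δ₀ := by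
      have h₂ := congrArg Trace.hs hτ'
      simp only [Trace.subst, Program.callTrace, Hist.subst, List.map_cons, List.cons.injEq,
        Elem.map, Elem.st.injEq] at h₂
      exact congrFun (congrArg State.loc h₂.1) v
    simp only [SymExpr.subst, hloc] at h₁
    cases hv : δ (.loc v) with
    | none => simp [hv] at h₁
    | some w =>
      simp only [hv, SymExpr.val.injEq] at h₁
      rw [hδ _ _ hv, h₁]
  obtain _ | ⟨a, _ | ⟨b, h'⟩⟩ := h
  · simp [Concretizes, Program.callTrace, Hist.subst, Hist.embed] at hh
  · simp [Concretizes, Program.callTrace, Hist.subst, Hist.embed] at hh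
  simp only [Concretizes, Program.callTrace, Hist.subst, Hist.embed, List.map_cons,
    List.cons.injEq] at hh
  obtain ⟨ha, hb, hh'⟩ := hh
  obtain ⟨s, rfl⟩ : ∃ s, a = .st s := by cases a <;> simp [Elem.map] at ha ⊢
  obtain ⟨X, f, as, rfl⟩ : ∃ X f as, b = .ev (.invREv X f m as) := by
    cases b with
    | ev e =>
      cases e <;> simp only [Elem.map, Event.map, Elem.ev.injEq, Event.invREv.injEq,
        reduceCtorEq] at hb
      exact ⟨_, _, _, by rw [hb.2.2.1]⟩
    | _ => simp [Elem.map] at hb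
  refine ⟨s, X, f, as, h', rfl, fun β => ?_⟩
  have hs (v : VarName) : s.loc v = P.initLoc m es v := by
    simp only [Elem.map, Elem.st.injEq] at ha
    have hv := congrFun (congrArg State.loc ha) v
    simp only [State.map, symState, SymExpr.subst, Concretizer.toSubst, SymExpr.val.injEq] at hv
    rw [← hv, hχ]
  have hhead : h'.head? = some (.st s) := by
    rw [hr] at hh'
    obtain _ | ⟨c, h'⟩ := h'
    · simp at hh'
    simp only [List.map_cons, List.cons.injEq] at hh'
    have hc : c.map SymExpr.val = (Elem.st s).map SymExpr.val := hh'.1.symm.trans ha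
    obtain ⟨s', rfl⟩ : ∃ s', c = .st s' := by cases c <;> simp [Elem.map] at hc ⊢
    simp only [Elem.map, Elem.st.injEq, State.map, State.mk.injEq] at hc
    have hls : s'.loc = s.loc := funext fun v => SymExpr.val.inj (congrFun hc.1 v)
    have hhs : s'.heap = s.heap := funext fun f => SymExpr.val.inj (congrFun hc.2 f)
    simp only [List.head?_cons, Option.some.injEq, Elem.st.injEq]
    cases s; cases s'; simp_all
  exact hvalid m C M hl s β (hpre β s hs) h'
    ⟨_, χ, τ, hsel, ⟨C, M, ∅, [], 1, symState C.parNames, hl, .refl _, hτ, by simp⟩, hh', hhead⟩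

/-- Every process of the system descends, by agreements from `As`, from one of the processes in
`started` that meets its precondition. -/
def Sys.Controlled {P : Program} (S : Sys P) (I : Interp) (T : MName → Protocol)
    (As : List Agreement) (started : List (MName × Set Trace)) : Prop :=
  ∀ p, S.HasProc p → ∃ m Θ, (m, Θ) ∈ started ∧ MeetsPre P I T m Θ ∧ Descends As Θ p

/-- A call meets the precondition of the called method, if all processes so far are started with
their preconditions. For the calling step belongs to a selected trace of the caller, which satisfies
the type of the caller, so that some call action of this type describes the invocation event. -/
theorem SysStep.meetsPre {P : Program} {I : Interp} {T : MName → Protocol}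
    (hpre : ParameterPreconditions P T)
    (hvalid : ∀ m C M, P.lookup m = some (C, M) →
      ObligationValid P I m (T m).pre M.body ((T m).formula P))
    (hcons : Consistent P I T) {S₀ S S₁ S' : Sys P} {Θ₀ : Set Trace} {L ls : List StepLabel}
    {l : StepLabel} (hinit : IsInitial P S₀ Θ₀) (hfull : Run P S₀ L S') (hterm : S'.Terminated)
    (hs : SysStep P S l S₁) (hrun : Run P S₁ ls S') (hL : l :: ls ⊆ L)
    (hctl : S.Controlled I T (L.map StepLabel.agr)
      ((P.callMeth, Θ₀) :: L.filterMap StepLabel.spawn))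
    {m : MName} {Θ : Set Trace} (hΘ : l.spawn = some (m, Θ)) : MeetsPre P I T m Θ := by
  have hAs : (l :: ls).map StepLabel.agr ⊆ L.map StepLabel.agr := List.map_subset _ hL
  have halt : ∀ p, S.HasProc p → ∀ θ ∈ p, θ.hs.Alternates := fun p hp => by
    obtain ⟨_, _, -, ⟨_, hst, -⟩, hd⟩ := hctl p hp
    exact hd.alternates hst.alternates
  obtain ⟨X, X', f, es, hev, hst⟩ := hs.stepFacts.spawn m Θ hΘ
  refine ⟨es, hst, fun β s hsloc => ?_⟩
  obtain ⟨θ', hθ', χ', hf', hstep⟩ := Run.exists_follows_cons hs hrun hterm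
    (hAs (by simp)) (fun A hA => hAs (List.mem_cons_of_mem _ hA)) halt
  obtain ⟨m', Θ', hmem, hmeets, hdesc⟩ := hctl _ hs.stepFacts.proc
  obtain ⟨es', hst', -⟩ := id hmeets
  obtain ⟨θ₀, hθ₀, χ₀, hf₀, hsuf⟩ := hdesc.exists_follows hθ' hf'
  obtain ⟨h, hh⟩ := hf₀.concretizes hfull.valid (hst'.alternates θ₀ hθ₀)
  obtain ⟨θ, χ, δ, hsel, hδ, rfl, hχ⟩ := hst'.exists_selected hinit hfull hterm hmem hθ₀ hf₀
  obtain ⟨s₁, Y, g, as, h', rfl, hsat⟩ :=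
    hmeets.sat_formula hvalid hsel hδ hθ₀ (show Concretizes χ θ h from hχ.trans hh)
  have hin : [Elem.st l.agr.pre, .ev (.invEv X X' f m es)] <:+: h' := by
    have h₁ : l.agr.hist <:+: .st s₁ :: .ev (.invREv Y g m' as) :: h' := by
      refine Hist.infix_of_embed (List.IsInfix.trans hstep.isInfix ?_)
      rw [← show Hist.subst χ₀.toSubst _ = _ from hh]
      exact hsuf.isInfix
    have h₂ : [Elem.st l.agr.pre, .ev (.invEv X X' f m es)] <:+: l.agr.hist := by
      rw [← hev]
      exact ⟨[], [.st l.agr.post], rfl⟩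
    simpa [List.infix_cons_iff] using h₂.trans h₁
  obtain ⟨φ, hcall, hφ⟩ := Protocol.calls_of_sat (hsat β) hin
  obtain ⟨D', M', -, hl', -⟩ := hst'
  obtain ⟨D, M, -, hl, hlen, -⟩ := hst
  exact FOS.sat_initLoc (hpre m D M hl) hlen hsloc
    (hcons.1 m' D' M' m D M φ hl' hl hcall β _ ((FOS.sat_subst P I β _ _ φ).1 hφ))

/-- All processes that are started in a terminating run meet the preconditions of their methods. -/
theorem Run.meetsPre {P : Program} {I : Interp} {T : MName → Protocol}
    (hpre : ParameterPreconditions P T)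
    (hvalid : ∀ m C M, P.lookup m = some (C, M) →
      ObligationValid P I m (T m).pre M.body ((T m).formula P))
    (hcons : Consistent P I T) {S₀ S S' : Sys P} {Θ₀ : Set Trace} {L ls : List StepLabel}
    (hinit : IsInitial P S₀ Θ₀) (hfull : Run P S₀ L S') (hterm : S'.Terminated)
    (hrun : Run P S ls S') (hL : ls ⊆ L)
    (hctl : S.Controlled I T (L.map StepLabel.agr)
      ((P.callMeth, Θ₀) :: L.filterMap StepLabel.spawn)) :
    ∀ mΘ ∈ ls.filterMap StepLabel.spawn, MeetsPre P I T mΘ.1 mΘ.2 := by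
  induction hrun with
  | nil => simp
  | @cons S l S₁ ls S₂ hs hrun ih =>
    have hnew {m : MName} {Θ : Set Trace} (h : l.spawn = some (m, Θ)) : MeetsPre P I T m Θ :=
      hs.meetsPre hpre hvalid hcons hinit hfull hterm hrun hL hctl h
    have hl : l ∈ L := hL (by simp)
    have hctl₁ : S₁.Controlled I T (L.map StepLabel.agr)
        ((P.callMeth, Θ₀) :: L.filterMap StepLabel.spawn) := fun p hp => by
      rcases hs.stepFacts.after p hp with hp | rfl | ⟨m, hm⟩
      · exact hctl p hp
      · obtain ⟨m, Θ, hmem, hmeets, hd⟩ := hctl _ hs.stepFacts.proc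
        exact ⟨m, Θ, hmem, hmeets, .step (List.mem_map_of_mem hl) hs.stepFacts.valid hd⟩
      · exact ⟨m, p, List.mem_cons_of_mem _ (List.mem_filterMap.2 ⟨l, hl, hm⟩), hnew hm, .refl⟩
    intro mΘ hmem
    obtain ⟨l', hl', hm⟩ := List.mem_filterMap.1 hmem
    rcases List.mem_cons.1 hl' with rfl | hl'
    · exact hnew hm
    · exact ih hfull hterm (fun x hx => hL (List.mem_cons_of_mem _ hx)) hctl₁ mΘ
        (List.mem_filterMap.2 ⟨l', hl', hm⟩)

end CAO

theorem mainTheorem2 (P : CAO.Program) (I : CAO.Interp) (T : CAO.MName → CAO.Protocol)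
    (hpre : CAO.ParameterPreconditions P T)
    (hvalid : ∀ m C M, P.lookup m = some (C, M) →
      CAO.ObligationValid P I m (T m).pre M.body ((T m).formula P))
    (hcons : CAO.Consistent P I T)
    (m : CAO.MName) (θ : CAO.Trace) (χ : CAO.Concretizer)
    (hsel : CAO.SelectedTrace P m θ χ) :
    ∃ h : CAO.Hist CAO.Value, CAO.Concretizes χ θ h ∧
      ∀ β, CAO.MSO.Sat P I β (h.drop 2) ((T m).formula P) := by
  obtain ⟨-, S, Θ₀, ls, S', hinit, hrun, hterm, Θ, hmem, _, hθ, δ, hδ, rfl, hf⟩ := id hsel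
  have hmain : CAO.MeetsPre P I T P.callMeth Θ₀ := by
    obtain ⟨es, hst⟩ := hinit.startedWith
    exact ⟨es, hst, fun β s _ => hcons.2 β s⟩
  have hmeets : CAO.MeetsPre P I T m Θ := by
    rcases List.mem_cons.1 hmem with heq | hmem
    · cases heq
      exact hmain
    · exact hrun.meetsPre hpre hvalid hcons hinit hterm hrun (List.Subset.refl _)
        (fun p hp => ⟨_, _, List.mem_cons_self, hmain, hinit.eq_of_hasProc hp ▸ .refl⟩) _ hmem
  obtain ⟨es, hst, -⟩ := id hmeets
  obtain ⟨h, hh⟩ := hf.concretizes hrun.valid (hst.alternates _ hθ)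
  have hh' : CAO.Concretizes χ θ h := (CAO.Hist.subst_subst hδ θ.hs).symm.trans hh
  obtain ⟨s, X, f, as, h', rfl, hsat⟩ := hmeets.sat_formula hvalid hsel hδ hθ hh'
  exact ⟨_, hh', hsat⟩
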